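/- **Setting.** A finite concurrent safety game consists of finite non-empty sets $V$ (vertices), $X$ (actions of Eve), $Y$ (actions of Adam), a transition function $\delta:V\times X\times Y\to\mathcal D(V)$, a set of safe vertices, and observation functions $\varphi:V\cup X\to\Phi$ of Eve and $\psi:V\cup Y\to\Psi$ of Adam that are one-to-one on $V$ (actions may be invisible). At each step both players choose actions simultaneously and the next vertex is drawn from $\delta$; each player receives the signal of every visited vertex and of every action that she or he plays. Eve wins a play iff all its vertices are safe. A *behavioural strategy* of Eve is a map $\Phi^*\to\mathcal D(X)$, a *general strategy* is a probability measure on behavioural strategies (similarly for Adam, with $\Psi,Y$). A *general strategy with memory $M$* of Eve consists of an initial distribution in $\mathcal D(M)$, an update $\Phi\times M\to\mathcal D(M)$ applied at each signal received, and a next-action function $\Phi\times M\to\mathcal D(X)$ applied to the last signal and the current memory; it is a *behavioural strategy with memory $M$* if the initial memory and the update are deterministic. A strategy of Eve is *positive* from a vertex $q$ if, against every general strategy of Adam, she wins from $q$ with probability $>0$ (that is, Adam does not win almost surely). The *positive region* of Eve is the set of vertices from which she has a positive general strategy. Let $W_0=V$ and let $W_{i+1}$ be the least set $S\subseteq V$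 that contains all unsafe vertices and all vertices $q$ for which there is a set $B\subseteq Y$ such that for each $x\in X$: $\delta(q,x,y)(W_i)=1$ for all $y\in B$, and $\delta(q,x,y)(S)>0$ for some $y\in B$. Write $q\preceq r$ if $r\in W_i$ implies $q\in W_i$ for all $i$; this is a total preorder, and its equivalence classes are called classes. An action $x\in X$ is *safe* at $q$ if for each $y\in Y$, either $q\preceq r$ for all $r$ with $\delta(q,x,y)(r)>0$, or $q\prec r$ for some $x'\in X$ and $r$ with $\delta(q,x',y)(r)>0$. **Theorem.** In every finite concurrent safety game: 1. Eve has a general strategy with two memory states that is positive from every vertex of her positive region. 2. Every vertex of Eve's positive region has a safe action. Whenever a safe action is chosen at each such vertex (and arbitrary actions elsewhere), the following strategy is positive from every vertex of the positive region: Eve keeps a hidden state, Sound or Chance, which is drawn uniformly at the beginning, redrawn uniformly each time the play enters a new class, and unchanged otherwise; in the state Sound she plays the chosen action of the current vertex, in the state Chance she plays all actions with equal probabilities. (Besides the hidden state, Eve remembers the last visited vertex, so as to notice changes of class, and whether the next signal comes from a vertex or an action.) By contrast, there are a finite concurrent safety game and a vertex in Eve's positive region from which she has a positive behavioural strategy,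 but no positive behavioural strategy with finite memory. -/

import Mathlib

open MeasureTheory ProbabilityTheory
open scoped ENNReal

noncomputable section

/-- A concurrent arena (all signals are observed, and each player can recognise the current vertex
from its signal), with vertices `V`, actions `X` of Eve and `Y` of Adam, signals `Φ` of Eve and
`Ψ` of Adam.  Each player gets a signal for every vertex that is visited and for every action that
she or he plays; the signals of the actions are arbitrary, so actions may be invisible. -/
structure ConcurrentArena (V X Y Φ Ψ : Type*) where
  /-- transition function -/
  δ : V → X → Y → PMF V
  /-- observation function of Eve -/
  φ : V ⊕ X → Φ
  /-- observation function of Adam -/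
  ψ : V ⊕ Y → Ψ
  φ_injective : Function.Injective (fun v : V => φ (Sum.inl v))
  ψ_injective : Function.Injective (fun v : V => ψ (Sum.inl v))

/-- A concurrent safety game: Eve wins a play iff all of its vertices are safe. -/
structure ConcurrentSafetyGame (V X Y Φ Ψ : Type*) extends ConcurrentArena V X Y Φ Ψ where
  safe : Set V

/-- A behavioural strategy: it maps the sequence of signals received so far to a distribution over
the actions. -/
def BehaviouralStrategy (Sig Act : Type*) := List Sig → PMF Act

/-- The σ-algebra generated by the evaluations `b ↦ b h a`. -/
instance (Sig Act : Type*) : MeasurableSpace (BehaviouralStrategy Sig Act) :=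
  MeasurableSpace.comap (fun (b : List Sig → PMF Act) (h : List Sig) (a : Act) => (b h a : ℝ≥0∞))
    MeasurableSpace.pi

/-- A general strategy is a probability measure over behavioural strategies. -/
abbrev GeneralStrategy (Sig Act : Type*) := ProbabilityMeasure (BehaviouralStrategy Sig Act)

/-- A general strategy with memory `Mem`: initial memory, memory update and next action are all
randomised.  The memory is updated at each signal received; the next action depends on the last
signal and on the memory. -/
structure MemoryStrategy (Sig Act Mem : Type*) where
  init : PMF Mem
  update : Sig → Mem → PMF Mem
  act : Sig → Mem → PMF Act

/-- A behavioural strategy with memory `Mem`: only the next action is randomised. -/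
structure BehaviouralMemoryStrategy (Sig Act Mem : Type*) where
  init : Mem
  update : Sig → Mem → Mem
  act : Sig → Mem → PMF Act

/-- A behavioural strategy with memory, seen as a general strategy with memory. -/
def BehaviouralMemoryStrategy.toMemoryStrategy {Sig Act Mem : Type*}
    (σ : BehaviouralMemoryStrategy Sig Act Mem) : MemoryStrategy Sig Act Mem where
  init := PMF.pure σ.init
  update s m := PMF.pure (σ.update s m)
  act := σ.act

/-- A behavioural strategy, seen as a strategy whose memory is the whole sequence of signals. -/
def BehaviouralStrategy.toMemoryStrategy {Sig Act : Type*} (b : BehaviouralStrategy Sig Act) :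
    MemoryStrategy Sig Act (List Sig) where
  init := PMF.pure []
  update s h := PMF.pure (h ++ [s])
  act _ h := b h

/-- A configuration of the game: the current vertex and the current memories of both players. -/
@[ext] structure Configuration (V M N : Type*) where
  vertex : V
  memEve : M
  memAdam : N

instance (V M N : Type*) : MeasurableSpace (Configuration V M N) := ⊤

/-- A memory state of the Sound/Chance strategy: the random bit (`true` for Sound, `false` for
Chance), together with what Eve needs in order to notice a change of class: the last vertex that
was visited, and whether the next signal is that of a vertex. -/
structure SoundChanceMemory (V : Type*) where
  sound : Bool
  last : Option V
  awaitVertex : Bool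

namespace ConcurrentSafetyGame

variable {V X Y Φ Ψ M N : Type*} (G : ConcurrentSafetyGame V X Y Φ Ψ)

/-! ### Plays and values -/

/-- Initial configuration: both players draw their initial memories, then observe the initial
vertex `q` and update their memories. -/
def initConf (σ : MemoryStrategy Φ X M) (τ : MemoryStrategy Ψ Y N) (q : V) :
    PMF (Configuration V M N) :=
  (σ.init.bind (σ.update (G.φ (Sum.inl q)))).bind fun m =>
  (τ.init.bind (τ.update (G.ψ (Sum.inl q)))).bind fun n =>
  PMF.pure ⟨q, m, n⟩

/-- One step of the game: both players independently draw an action, the next vertex is drawn, and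
each player updates her or his memory with the signal of the own action, then with the signal of
the next vertex. -/
def step (σ : MemoryStrategy Φ X M) (τ : MemoryStrategy Ψ Y N) (c : Configuration V M N) :
    PMF (Configuration V M N) :=
  (σ.act (G.φ (Sum.inl c.vertex)) c.memEve).bind fun x =>
  (τ.act (G.ψ (Sum.inl c.vertex)) c.memAdam).bind fun y =>
  (G.δ c.vertex x y).bind fun v =>
  ((σ.update (G.φ (Sum.inr x)) c.memEve).bind (σ.update (G.φ (Sum.inl v)))).bind fun m =>
  ((τ.update (G.ψ (Sum.inr y)) c.memAdam).bind (τ.update (G.ψ (Sum.inl v)))).bind fun n =>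
  PMF.pure ⟨v, m, n⟩

/-- `step` as a Markov kernel from finite sequences of configurations. -/
def stepKernel (σ : MemoryStrategy Φ X M) (τ : MemoryStrategy Ψ Y N) (n : ℕ) :
    Kernel (Π _ : Finset.Iic n, Configuration V M N) (Configuration V M N) where
  toFun h := (G.step σ τ (h ⟨n, Finset.mem_Iic.2 le_rfl⟩)).toMeasure
  measurable' :=
    (measurable_from_top (f := fun c => (G.step σ τ c).toMeasure)).comp (measurable_pi_apply _)

instance (σ : MemoryStrategy Φ X M) (τ : MemoryStrategy Ψ Y N) (n : ℕ) :
    IsMarkovKernel (G.stepKernel σ τ n) :=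
  ⟨fun _ => PMF.toMeasure.isProbabilityMeasure _⟩

/-- The probability measure on infinite sequences of configurations that the strategies `σ`, `τ`
and the initial vertex `q` define. -/
def playMeasure (σ : MemoryStrategy Φ X M) (τ : MemoryStrategy Ψ Y N) (q : V) :
    Measure (ℕ → Configuration V M N) :=
  Kernel.trajMeasure (X := fun _ => Configuration V M N) (G.initConf σ τ q).toMeasure
    (G.stepKernel σ τ)

/-- The probability that Eve wins from `q` when the players use strategies with memory. -/
def memValue (σ : MemoryStrategy Φ X M) (τ : MemoryStrategy Ψ Y N) (q : V) : ℝ≥0∞ :=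
  G.playMeasure σ τ q {ω | ∀ n, (ω n).vertex ∈ G.safe}

/-- The probability that Eve wins from `q` when both players use general strategies. -/
def generalValue (σ : GeneralStrategy Φ X) (τ : GeneralStrategy Ψ Y) (q : V) : ℝ≥0∞ :=
  ∫⁻ b, ∫⁻ c, G.memValue b.toMemoryStrategy c.toMemoryStrategy q
    ∂(τ : Measure (BehaviouralStrategy Ψ Y)) ∂(σ : Measure (BehaviouralStrategy Φ X))

/-- A general strategy of Eve is positive from `q` if she wins with positive probability against
every strategy of Adam. -/
def IsPositiveGeneral (σ : GeneralStrategy Φ X) (q : V) : Prop :=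
  ∀ τ : GeneralStrategy Ψ Y, 0 < G.generalValue σ τ q

/-- The same for a strategy of Eve with memory. -/
def IsPositive (σ : MemoryStrategy Φ X M) (q : V) : Prop :=
  ∀ τ : GeneralStrategy Ψ Y,
    0 < ∫⁻ c, G.memValue σ c.toMemoryStrategy q ∂(τ : Measure (BehaviouralStrategy Ψ Y))

/-- The positive region of Eve. -/
def positiveRegion : Set V := {q | ∃ σ : GeneralStrategy Φ X, G.IsPositiveGeneral σ q}

/-! ### The preorder and the safe actions -/

/-- The vertices at which Adam can mix a set `B` of actions such that, whatever Eve plays, the next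
vertex is surely in `W` and is in `S` with positive probability. -/
def almostPre (W S : Set V) : Set V :=
  {q | ∃ B : Set Y, ∀ x : X,
    (∀ y ∈ B, ∀ r ∈ (G.δ q x y).support, r ∈ W) ∧ ∃ y ∈ B, ∃ r ∈ (G.δ q x y).support, r ∈ S}

/-- The least fixpoint `μ S. (unsafe ∪ almostPre W S)`. -/
def attractor (W : Set V) : Set V :=
  ⋂₀ {S | G.safeᶜ ∪ G.almostPre W S ⊆ S}

/-- The iteration from above of the greatest fixpoint `ν W. μ S. (unsafe ∪ almostPre W S)`. -/
def layer : ℕ → Set V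
  | 0 => Set.univ
  | i + 1 => G.attractor (layer i)

/-- The total preorder derived from the fixpoint iteration: a vertex is lower if it stays longer in
the decreasing sequence of layers. -/
def prec (q r : V) : Prop := ∀ i, r ∈ G.layer i → q ∈ G.layer i

/-- `x` is a safe action at `q` if each action `y` of Adam either never leads to a lower class
against `x`, or leads with positive probability to a higher class against some action of Eve. -/
def IsSafeAction (q : V) (x : X) : Prop :=
  ∀ y : Y, (∀ r ∈ (G.δ q x y).support, G.prec q r) ∨
    ∃ x' : X, ∃ r ∈ (G.δ q x' y).support, G.prec q r ∧ ¬ G.prec r q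

/-! ### The Sound/Chance strategy -/

/-- The vertex with a given signal. -/
def vertexOf [Nonempty V] (s : Φ) : V := Function.invFun (fun v : V => G.φ (Sum.inl v)) s

open Classical in
/-- The Sound/Chance strategy for the actions `act q`: when the play enters a new class (and at the
beginning), the bit is drawn uniformly, and otherwise it does not change; in the Sound state, Eve
plays the action `act q` of the current vertex `q`; in the Chance state, she plays all actions with
equal probabilities. -/
def soundChance [Nonempty V] [Fintype X] [Nonempty X] (act : V → X) :
    MemoryStrategy Φ X (SoundChanceMemory V) where
  init := (PMF.uniformOfFintype Bool).bind fun b => PMF.pure ⟨b, none, true⟩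
  update s m :=
    if m.awaitVertex then
      if ∃ u, m.last = some u ∧ G.prec u (G.vertexOf s) ∧ G.prec (G.vertexOf s) u then
        PMF.pure ⟨m.sound, some (G.vertexOf s), false⟩
      else
        (PMF.uniformOfFintype Bool).bind fun b => PMF.pure ⟨b, some (G.vertexOf s), false⟩
    else PMF.pure ⟨m.sound, m.last, true⟩
  act s m := if m.sound then PMF.pure (act (G.vertexOf s)) else PMF.uniformOfFintype X

end ConcurrentSafetyGame

end

/-! Let `W` be a layer with `attractor W = W`; one exists because the layers decrease in a finite
lattice. Eve's positive region is the complement of `W`.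

Inside `W`, Adam plays memorylessly, with full support on the actions that confine the play to `W`.
While the play is safe it stays in `W`, and by induction over the least fixpoint, an unsafe vertex
is reached within a bounded time with probability bounded away from zero (`exists_surv_le`).
Repetition makes Eve's winning probability zero (`confValue_eq_zero`).

Outside `W`, the key is `exists_confValue_pos`, an argument by contradiction for a fixed strategy of
Adam, by induction on the layers. Suppose that all memory states of `K v` have value zero. If Adam's
next action could raise the play to a higher class against some action of Eve, a state of `K v`
could play that action and reach a state of positive value. So Adam never takes such a risk. By the
definition of a safe action, the Sound state then never drops to a lower class. The play stays in
one class of safe vertices forever and Eve wins surely, which is absurd. Only supports matter, so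
the lemma serves three strategies: `soundChance`, the two-state `switchToSound`, and a random
mixture of `countdown` strategies. The mixture supplies a measure on behavioural strategies, as
membership in the positive region requires.

For the lower bound, in `HideOrRun` Eve must keep a positive chance of throwing at every moment, yet
with positive probability never throw if Adam hides forever. Throwing probabilities with a small sum
achieve this. With finite deterministic memory some state recurs along the waiting play, so the
throwing probabilities either vanish once or have a divergent sum. -/

noncomputable section

/-! ### Expectations under discrete distributions. -/

namespace PMF

variable {α β : Type*}

/-- The expectation of a nonnegative function. -/
def expect (p : PMF α) (f : α → ℝ≥0∞) : ℝ≥0∞ := ∑' a, p a * f a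

theorem expect_pure (a : α) (f : α → ℝ≥0∞) : (PMF.pure a).expect f = f a := by
  rw [expect, tsum_eq_single a]
  · simp
  · intro b hb
    simp [hb]

theorem expect_bind (p : PMF α) (g : α → PMF β) (f : β → ℝ≥0∞) :
    (p.bind g).expect f = p.expect fun a => (g a).expect f := by
  simp only [expect, bind_apply, ← ENNReal.tsum_mul_right, ← ENNReal.tsum_mul_left]
  rw [ENNReal.tsum_comm]
  simp only [mul_assoc]

theorem expect_mono (p : PMF α) {f g : α → ℝ≥0∞} (h : ∀ a ∈ p.support, f a ≤ g a) :
    p.expect f ≤ p.expect g := by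
  refine ENNReal.tsum_le_tsum fun a => ?_
  by_cases ha : p a = 0
  · simp [ha]
  · exact mul_le_mul_right (h a ha) _

theorem expect_congr (p : PMF α) {f g : α → ℝ≥0∞} (h : ∀ a ∈ p.support, f a = g a) :
    p.expect f = p.expect g :=
  le_antisymm (p.expect_mono fun a ha => (h a ha).le) (p.expect_mono fun a ha => (h a ha).ge)

theorem expect_const (p : PMF α) (c : ℝ≥0∞) : (p.expect fun _ => c) = c := by
  simp [expect, ENNReal.tsum_mul_right, p.tsum_coe]

theorem expect_mul_const (p : PMF α) (f : α → ℝ≥0∞) (c : ℝ≥0∞) :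
    (p.expect fun a => f a * c) = p.expect f * c := by
  simp [expect, ← ENNReal.tsum_mul_right, mul_assoc]

theorem mul_le_expect (p : PMF α) (f : α → ℝ≥0∞) (a : α) : p a * f a ≤ p.expect f :=
  ENNReal.le_tsum a

theorem expect_le_of_forall_le (p : PMF α) {f : α → ℝ≥0∞} {c : ℝ≥0∞}
    (h : ∀ a ∈ p.support, f a ≤ c) : p.expect f ≤ c :=
  (p.expect_mono h).trans_eq (p.expect_const c)

/-- If a function is at most `1` and at most `ε` at a point of mass `p a`, then its expectation is
at most `1 - p a * (1 - ε)`. -/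
theorem expect_le_one_sub (p : PMF α) {f : α → ℝ≥0∞} (h : ∀ b, f b ≤ 1) {a : α} {ε : ℝ≥0∞}
    (ha : f a ≤ ε) : p.expect f ≤ 1 - p a * (1 - ε) := by
  have hne : p a * (1 - ε) ≠ ∞ :=
    ENNReal.mul_ne_top (p.apply_ne_top a) (ne_top_of_le_ne_top ENNReal.one_ne_top tsub_le_self)
  refine ENNReal.le_sub_of_add_le_right hne ?_
  calc p.expect f + p a * (1 - ε)
      ≤ p.expect f + p a * (1 - f a) := by gcongr
    _ ≤ p.expect f + p.expect (fun b => 1 - f b) := by gcongr; exact p.mul_le_expect _ a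
    _ = p.expect fun _ => 1 := by
        rw [expect, expect, expect, ← ENNReal.tsum_add]
        refine tsum_congr fun b => ?_
        rw [← mul_add, add_tsub_cancel_of_le (h b)]
    _ = 1 := p.expect_const 1

theorem lintegral_toMeasure [MeasurableSpace α] (p : PMF α) {f : α → ℝ≥0∞} (hf : Measurable f) :
    ∫⁻ a, f a ∂p.toMeasure = p.expect f := by
  have : p.toMeasure = Measure.sum fun a => p a • Measure.dirac a := by
    ext s hs
    rw [toMeasure_apply p hs, Measure.sum_apply _ hs]
    refine tsum_congr fun a => ?_
    by_cases ha : a ∈ s <;> simp [ha, hs]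
  rw [this, lintegral_sum_measure, expect]
  simp [lintegral_smul_measure, lintegral_dirac' _ hf]

theorem exists_support_eq [Finite α] {s : Set α} (hs : s.Nonempty) :
    ∃ p : PMF α, p.support = s := by
  classical
  refine ⟨PMF.uniformOfFinset s.toFinite.toFinset (by simpa using hs), ?_⟩
  ext a
  simp

end PMF

/-! ### Finite-horizon survival probabilities and their relation to the play measure. -/

namespace ConcurrentSafetyGame

variable {V X Y Φ Ψ M N : Type*} (G : ConcurrentSafetyGame V X Y Φ Ψ)

open Classical in
/-- The probability that the current vertex and the next `n` vertices are safe. -/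
def surv (σ : MemoryStrategy Φ X M) (τ : MemoryStrategy Ψ Y N) :
    ℕ → Configuration V M N → ℝ≥0∞
  | 0, c => if c.vertex ∈ G.safe then 1 else 0
  | n + 1, c => if c.vertex ∈ G.safe then (G.step σ τ c).expect (surv σ τ n) else 0

theorem expect_step (σ : MemoryStrategy Φ X M) (τ : MemoryStrategy Ψ Y N)
    (c : Configuration V M N) (f : Configuration V M N → ℝ≥0∞) :
    (G.step σ τ c).expect f =
      (σ.act (G.φ (Sum.inl c.vertex)) c.memEve).expect fun x =>
      (τ.act (G.ψ (Sum.inl c.vertex)) c.memAdam).expect fun y =>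
      (G.δ c.vertex x y).expect fun v =>
      ((σ.update (G.φ (Sum.inr x)) c.memEve).expect fun m' =>
        (σ.update (G.φ (Sum.inl v)) m').expect fun m =>
      (τ.update (G.ψ (Sum.inr y)) c.memAdam).expect fun n' =>
        (τ.update (G.ψ (Sum.inl v)) n').expect fun n => f ⟨v, m, n⟩) := by
  simp only [step, PMF.expect_bind, PMF.expect_pure]

theorem expect_initConf (σ : MemoryStrategy Φ X M) (τ : MemoryStrategy Ψ Y N) (q : V)
    (f : Configuration V M N → ℝ≥0∞) :
    (G.initConf σ τ q).expect f =
      σ.init.expect fun m' => (σ.update (G.φ (Sum.inl q)) m').expect fun m =>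
      τ.init.expect fun n' => (τ.update (G.ψ (Sum.inl q)) n').expect fun n => f ⟨q, m, n⟩ := by
  simp only [initConf, PMF.expect_bind, PMF.expect_pure]

section Value

variable (σ : MemoryStrategy Φ X M) (τ : MemoryStrategy Ψ Y N)

theorem surv_of_notMem {c : Configuration V M N} (hc : c.vertex ∉ G.safe) (n : ℕ) :
    G.surv σ τ n c = 0 := by
  cases n <;> simp [surv, hc]

theorem surv_succ {c : Configuration V M N} (hc : c.vertex ∈ G.safe) (n : ℕ) :
    G.surv σ τ (n + 1) c = (G.step σ τ c).expect (G.surv σ τ n) := by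
  simp [surv, hc]

theorem surv_le_one (n : ℕ) (c : Configuration V M N) : G.surv σ τ n c ≤ 1 := by
  induction n generalizing c with
  | zero => rw [surv]; split_ifs <;> simp
  | succ n ih =>
    rw [surv]
    split_ifs
    · exact PMF.expect_le_of_forall_le _ fun c' _ => ih c'
    · simp

theorem surv_succ_le (n : ℕ) (c : Configuration V M N) :
    G.surv σ τ (n + 1) c ≤ G.surv σ τ n c := by
  induction n generalizing c with
  | zero =>
    by_cases hc : c.vertex ∈ G.safe
    · simpa [surv, hc] using PMF.expect_le_of_forall_le _ fun c' _ => G.surv_le_one σ τ 0 c'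
    · simp [surv, hc]
  | succ n ih =>
    by_cases hc : c.vertex ∈ G.safe
    · rw [surv_succ _ _ _ hc, surv_succ _ _ _ hc]
      exact PMF.expect_mono _ fun c' _ => ih c'
    · simp [surv, hc]

theorem surv_antitone (c : Configuration V M N) : Antitone fun n => G.surv σ τ n c :=
  antitone_nat_of_succ_le fun n => G.surv_succ_le σ τ n c

/-- The probability that Eve wins from a configuration. -/
def confValue (c : Configuration V M N) : ℝ≥0∞ := ⨅ n, G.surv σ τ n c

theorem step_mul_confValue_le {c : Configuration V M N} (hc : c.vertex ∈ G.safe)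
    (c' : Configuration V M N) :
    G.step σ τ c c' * G.confValue σ τ c' ≤ G.confValue σ τ c := by
  refine le_iInf fun n => le_trans ?_ (G.surv_succ_le σ τ n c)
  rw [surv_succ _ _ _ hc]
  exact (mul_le_mul_right (iInf_le _ n) _).trans (PMF.mul_le_expect _ _ c')

/-- Positivity propagates backwards along every possible step, so Eve's side of the proof can reason
about supports instead of probabilities. -/
theorem confValue_pos_of_step {c c' : Configuration V M N} (hc : c.vertex ∈ G.safe)
    (h : c' ∈ (G.step σ τ c).support) (hc' : 0 < G.confValue σ τ c') :
    0 < G.confValue σ τ c :=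
  (ENNReal.mul_pos h hc'.ne').trans_le (G.step_mul_confValue_le σ τ hc c')

theorem mem_support_step {c c' : Configuration V M N} :
    c' ∈ (G.step σ τ c).support ↔
      ∃ x ∈ (σ.act (G.φ (Sum.inl c.vertex)) c.memEve).support,
      ∃ y ∈ (τ.act (G.ψ (Sum.inl c.vertex)) c.memAdam).support,
      c'.vertex ∈ (G.δ c.vertex x y).support ∧
      c'.memEve ∈ ((σ.update (G.φ (Sum.inr x)) c.memEve).bind
        (σ.update (G.φ (Sum.inl c'.vertex)))).support ∧
      c'.memAdam ∈ ((τ.update (G.ψ (Sum.inr y)) c.memAdam).bind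
        (τ.update (G.ψ (Sum.inl c'.vertex)))).support := by
  rcases c' with ⟨v, m, n⟩
  simp only [step, PMF.mem_support_bind_iff, PMF.mem_support_pure_iff, Configuration.mk.injEq]
  constructor
  · rintro ⟨x, hx, y, hy, v', hv, m', hm, n', hn, rfl, rfl, rfl⟩
    exact ⟨x, hx, y, hy, hv, hm, hn⟩
  · rintro ⟨x, hx, y, hy, hv, hm, hn⟩
    exact ⟨x, hx, y, hy, v, hv, m, hm, n, hn, rfl, rfl, rfl⟩

/-- The Markov property of the play. -/
theorem lintegral_playMeasure_succ (q : V) (n : ℕ)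
    {f : (Π _ : Finset.Iic n, Configuration V M N) → ℝ≥0∞} (hf : Measurable f)
    (g : Configuration V M N → ℝ≥0∞) :
    ∫⁻ ω, f (Preorder.frestrictLe n ω) * g (ω (n + 1)) ∂G.playMeasure σ τ q =
      ∫⁻ ω, f (Preorder.frestrictLe n ω) * (G.step σ τ (ω n)).expect g
        ∂G.playMeasure σ τ q := by
  have hg : Measurable g := measurable_from_top
  have hprod : Measurable fun p : (Π _ : Finset.Iic n, Configuration V M N) ×
      Configuration V M N => f p.1 * g p.2 :=
    (hf.comp measurable_fst).mul (hg.comp measurable_snd)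
  have key := Kernel.map_frestrictLe_trajMeasure_compProd_eq_map_trajMeasure
    (X := fun _ => Configuration V M N) (μ₀ := (G.initConf σ τ q).toMeasure)
    (κ := G.stepKernel σ τ) (a := n)
  have h1 := congrArg (fun μ => ∫⁻ p, f p.1 * g p.2 ∂μ) key
  rw [Measure.lintegral_compProd hprod, lintegral_map hprod (by fun_prop)] at h1
  refine h1.symm.trans ?_
  rw [lintegral_map]
  · refine lintegral_congr fun ω => ?_
    refine (lintegral_const_mul (f (Preorder.frestrictLe n ω)) hg).trans ?_
    congr 1
    exact PMF.lintegral_toMeasure _ hg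
  · exact hprod.lintegral_kernel_prod_right'
  · fun_prop

theorem lintegral_playMeasure_zero (q : V) (g : Configuration V M N → ℝ≥0∞) :
    ∫⁻ ω, g (ω 0) ∂G.playMeasure σ τ q = (G.initConf σ τ q).expect g := by
  have hg : Measurable g := measurable_from_top
  have hg0 : Measurable fun ω : ℕ → Configuration V M N => g (ω 0) :=
    hg.comp (measurable_pi_apply 0)
  have hr : Measurable fun x : (Π _ : Finset.Iic 0, Configuration V M N) =>
      g (x ⟨0, Finset.mem_Iic.2 le_rfl⟩) := hg.comp (measurable_pi_apply _)
  rw [playMeasure, Kernel.trajMeasure, Measure.lintegral_bind (Kernel.aemeasurable _)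
    hg0.aemeasurable]
  have h : ∀ x : (Π _ : Finset.Iic 0, Configuration V M N),
      ∫⁻ ω, g (ω 0) ∂Kernel.traj (X := fun _ => Configuration V M N) (G.stepKernel σ τ) 0 x =
        g (x ⟨0, Finset.mem_Iic.2 le_rfl⟩) := by
    intro x
    have h1 := congrArg (fun κ => κ x) (Kernel.traj_map_frestrictLe_of_le
      (X := fun _ => Configuration V M N) (κ := G.stepKernel σ τ) (le_refl 0))
    have h2 := congrArg (fun μ => ∫⁻ p, g (p ⟨0, Finset.mem_Iic.2 le_rfl⟩) ∂μ) h1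
    rw [Kernel.map_apply _ (by fun_prop), lintegral_map hr (by fun_prop),
      Kernel.deterministic_apply, lintegral_dirac' _ hr] at h2
    exact h2
  simp only [h]
  rw [lintegral_map hr (by fun_prop)]
  exact PMF.lintegral_toMeasure _ hg

open Classical in
/-- The indicator of the plays that are safe up to time `n`. -/
def safeUpTo (n : ℕ) (h : Π _ : Finset.Iic n, Configuration V M N) : ℝ≥0∞ :=
  if ∀ i, (h i).vertex ∈ G.safe then 1 else 0

theorem measurableSet_safeUpTo (n : ℕ) :
    MeasurableSet {h : Π _ : Finset.Iic n, Configuration V M N | ∀ i, (h i).vertex ∈ G.safe} := by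
  simp only [Set.ofPred_forall]
  exact MeasurableSet.iInter fun i =>
    (measurable_pi_apply i : Measurable fun h : (Π _ : Finset.Iic n, Configuration V M N) => h i)
      (MeasurableSpace.measurableSet_top (s := {c : Configuration V M N | c.vertex ∈ G.safe}))

theorem measurable_safeUpTo (n : ℕ) :
    Measurable (G.safeUpTo (M := M) (N := N) n) :=
  Measurable.ite (G.measurableSet_safeUpTo n) measurable_const measurable_const

theorem safeUpTo_succ_mul (n : ℕ) (ω : ℕ → Configuration V M N) (g : Configuration V M N → ℝ≥0∞)
    (hg : ∀ c, c.vertex ∉ G.safe → g c = 0) :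
    G.safeUpTo (n + 1) (Preorder.frestrictLe (n + 1) ω) * g (ω (n + 1)) =
      G.safeUpTo n (Preorder.frestrictLe n ω) * g (ω (n + 1)) := by
  by_cases h : (ω (n + 1)).vertex ∈ G.safe
  · congr 1
    simp only [safeUpTo]
    congr 1
    simp only [Preorder.frestrictLe_apply, Subtype.forall, Finset.mem_Iic, eq_iff_iff]
    constructor
    · exact fun H i hi => H i (by omega)
    · intro H i hi
      rcases Nat.lt_or_ge n i with h' | h'
      · rwa [show i = n + 1 by omega]
      · exact H i h'
  · simp [hg _ h]

theorem safeUpTo_mul_congr (n : ℕ) (ω : ℕ → Configuration V M N)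
    {f g : Configuration V M N → ℝ≥0∞} (h : ∀ c, c.vertex ∈ G.safe → f c = g c) :
    G.safeUpTo n (Preorder.frestrictLe n ω) * f (ω n) =
      G.safeUpTo n (Preorder.frestrictLe n ω) * g (ω n) := by
  by_cases hn : (ω n).vertex ∈ G.safe
  · rw [h _ hn]
  · have : G.safeUpTo n (Preorder.frestrictLe n ω) = 0 :=
      if_neg fun H => hn (H ⟨n, Finset.mem_Iic.2 le_rfl⟩)
    simp [this]

/-- Each induction step uses the Markov property to trade one step of the actual play for one step
of the recursion `surv`; the total horizon `n + m` is unchanged. -/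
theorem lintegral_safeUpTo_mul_surv (q : V) (n m : ℕ) :
    ∫⁻ ω, G.safeUpTo n (Preorder.frestrictLe n ω) * G.surv σ τ m (ω n) ∂G.playMeasure σ τ q =
      (G.initConf σ τ q).expect (G.surv σ τ (n + m)) := by
  induction n generalizing m with
  | zero =>
    rw [Nat.zero_add, ← lintegral_playMeasure_zero]
    refine lintegral_congr fun ω => ?_
    by_cases h : (ω 0).vertex ∈ G.safe
    · have : G.safeUpTo 0 (Preorder.frestrictLe 0 ω) = 1 := by
        refine if_pos fun i => ?_
        obtain ⟨i, hi⟩ := i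
        obtain rfl : i = 0 := by simpa using hi
        exact h
      rw [this, one_mul]
    · rw [G.surv_of_notMem σ τ h, mul_zero]
  | succ n ih =>
    rw [show n + 1 + m = n + (m + 1) by omega, ← ih (m + 1)]
    calc _ = ∫⁻ ω, G.safeUpTo n (Preorder.frestrictLe n ω) * G.surv σ τ m (ω (n + 1))
          ∂G.playMeasure σ τ q :=
          lintegral_congr fun ω =>
            G.safeUpTo_succ_mul n ω _ fun c hc => G.surv_of_notMem σ τ hc m
      _ = _ := G.lintegral_playMeasure_succ σ τ q n (G.measurable_safeUpTo n) _
      _ = _ := lintegral_congr fun ω =>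
          G.safeUpTo_mul_congr n ω fun c hc => (G.surv_succ σ τ hc m).symm

/-- Continuity from above along the decreasing events of being safe up to time `n`. All later
arguments about `memValue` rest on this recursion rather than on the measure on infinite plays. -/
theorem memValue_eq_iInf (q : V) :
    G.memValue σ τ q = ⨅ n, (G.initConf σ τ q).expect (G.surv σ τ n) := by
  let A (n : ℕ) : Set (ℕ → Configuration V M N) :=
    Preorder.frestrictLe (π := fun _ => Configuration V M N) n ⁻¹'
      {h | ∀ i, (h i).vertex ∈ G.safe}
  have hA : ∀ n, MeasurableSet (A n) := fun n =>
    Preorder.measurable_frestrictLe n (G.measurableSet_safeUpTo n)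
  have hset : {ω : ℕ → Configuration V M N | ∀ n, (ω n).vertex ∈ G.safe} = ⋂ n, A n := by
    ext ω
    simp only [A, Set.mem_ofPred_eq, Set.mem_iInter, Set.mem_preimage, Subtype.forall,
      Finset.mem_Iic, Preorder.frestrictLe_apply]
    exact ⟨fun h n i _ => h i, fun h n => h n n le_rfl⟩
  have hanti : Antitone A := by
    intro n m hnm ω h i
    exact h ⟨i.1, Finset.mem_Iic.2 ((Finset.mem_Iic.1 i.2).trans hnm)⟩
  have : IsProbabilityMeasure (G.playMeasure σ τ q) := by
    unfold playMeasure
    infer_instance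
  rw [memValue, hset, hanti.measure_iInter (fun n => (hA n).nullMeasurableSet)
    ⟨0, measure_ne_top _ _⟩]
  congr 1
  funext n
  rw [← Nat.add_zero n, ← lintegral_safeUpTo_mul_surv, Nat.add_zero, ← lintegral_indicator_one (hA n)]
  refine lintegral_congr fun ω => ?_
  by_cases h : ω ∈ A n
  · have h1 : G.safeUpTo n (Preorder.frestrictLe n ω) = 1 := if_pos h
    have h2 : G.surv σ τ 0 (ω n) = 1 := if_pos (h ⟨n, Finset.mem_Iic.2 le_rfl⟩)
    simp [h, h1, h2]
  · have h1 : G.safeUpTo n (Preorder.frestrictLe n ω) = 0 := if_neg h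
    simp [h, h1]

theorem memValue_le_expect_surv (q : V) (n : ℕ) :
    G.memValue σ τ q ≤ (G.initConf σ τ q).expect (G.surv σ τ n) :=
  (G.memValue_eq_iInf σ τ q).trans_le (iInf_le _ n)

theorem memValue_pos_of_initConf {q : V} {c : Configuration V M N}
    (hc : c ∈ (G.initConf σ τ q).support) (h : 0 < G.confValue σ τ c) :
    0 < G.memValue σ τ q := by
  rw [memValue_eq_iInf]
  refine (ENNReal.mul_pos hc h.ne').trans_le (le_iInf fun n => ?_)
  exact (mul_le_mul_right (iInf_le _ n) _).trans (PMF.mul_le_expect _ _ c)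

theorem mem_support_initConf {q : V} {m : M} {n : N}
    (hm : m ∈ (σ.init.bind (σ.update (G.φ (Sum.inl q)))).support)
    (hn : n ∈ (τ.init.bind (τ.update (G.ψ (Sum.inl q)))).support) :
    (⟨q, m, n⟩ : Configuration V M N) ∈ (G.initConf σ τ q).support := by
  rw [initConf, PMF.mem_support_bind_iff]
  refine ⟨m, hm, ?_⟩
  rw [PMF.mem_support_bind_iff]
  exact ⟨n, hn, (PMF.mem_support_pure_iff _ _).2 rfl⟩

end Value

/-! ### Measurability -/

/-- A family of strategies with memory whose expectations are measurable in the parameter. -/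
structure MeasurableFamily {Ω Sig Act Mem : Type*} [MeasurableSpace Ω]
    (σ : Ω → MemoryStrategy Sig Act Mem) : Prop where
  init : ∀ f : Ω → Mem → ℝ≥0∞, (∀ m, Measurable fun ω => f ω m) →
    Measurable fun ω => (σ ω).init.expect (f ω)
  update : ∀ s m, ∀ f : Ω → Mem → ℝ≥0∞, (∀ m, Measurable fun ω => f ω m) →
    Measurable fun ω => ((σ ω).update s m).expect (f ω)
  act : ∀ s m, ∀ f : Ω → Act → ℝ≥0∞, (∀ x, Measurable fun ω => f ω x) →
    Measurable fun ω => ((σ ω).act s m).expect (f ω)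

theorem _root_.PMF.measurable_expect {Ω α : Type*} [MeasurableSpace Ω] [Countable α]
    {p : Ω → PMF α} (hp : ∀ a, Measurable fun ω => p ω a) {f : Ω → α → ℝ≥0∞}
    (hf : ∀ a, Measurable fun ω => f ω a) : Measurable fun ω => (p ω).expect (f ω) :=
  Measurable.tsum fun a => (hp a).mul (hf a)

theorem MeasurableFamily.const {Ω Sig Act Mem : Type*} [MeasurableSpace Ω] [Countable Act]
    [Countable Mem] (σ : MemoryStrategy Sig Act Mem) : MeasurableFamily fun _ : Ω => σ where
  init _ hf := PMF.measurable_expect (fun _ => measurable_const) hf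
  update _ _ _ hf := PMF.measurable_expect (fun _ => measurable_const) hf
  act _ _ _ hf := PMF.measurable_expect (fun _ => measurable_const) hf

theorem measurable_behaviour_apply {Sig Act : Type*} (l : List Sig) (a : Act) :
    Measurable fun b : BehaviouralStrategy Sig Act => b l a := by
  have h : Measurable fun (b : BehaviouralStrategy Sig Act) (h : List Sig) (a : Act) =>
      (b h a : ℝ≥0∞) := comap_measurable _
  exact (measurable_pi_apply a).comp ((measurable_pi_apply l).comp h)

/-- The memory `List Sig` may be uncountable, but its initial value and its updates are point
masses, so only the sum over actions needs countability. -/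
theorem MeasurableFamily.behavioural {Ω Sig Act : Type*} [MeasurableSpace Ω] [Countable Act]
    {b : Ω → BehaviouralStrategy Sig Act} (hb : Measurable b) :
    MeasurableFamily fun ω => (b ω).toMemoryStrategy where
  init f hf := by simpa [BehaviouralStrategy.toMemoryStrategy, PMF.expect_pure] using hf []
  update s m f hf := by
    simpa [BehaviouralStrategy.toMemoryStrategy, PMF.expect_pure] using hf (m ++ [s])
  act s m f hf :=
    PMF.measurable_expect (fun a => (measurable_behaviour_apply m a).comp hb) hf

variable {Ω : Type*} [MeasurableSpace Ω] [Countable V]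

theorem measurable_surv {σ : Ω → MemoryStrategy Φ X M} {τ : Ω → MemoryStrategy Ψ Y N}
    (hσ : MeasurableFamily σ) (hτ : MeasurableFamily τ) (n : ℕ) (c : Configuration V M N) :
    Measurable fun ω => G.surv (σ ω) (τ ω) n c := by
  induction n generalizing c with
  | zero => exact measurable_const
  | succ n ih =>
    by_cases hc : c.vertex ∈ G.safe
    · simp only [surv_succ _ _ _ hc, expect_step]
      refine hσ.act _ _ _ fun x => hτ.act _ _ _ fun y =>
        PMF.measurable_expect (fun _ => measurable_const) fun v => hσ.update _ _ _ fun _ =>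
        hσ.update _ _ _ fun _ => hτ.update _ _ _ fun _ => hτ.update _ _ _ fun _ => ih _
    · simp only [surv_of_notMem _ _ _ hc, measurable_const]

theorem measurable_memValue {σ : Ω → MemoryStrategy Φ X M} {τ : Ω → MemoryStrategy Ψ Y N}
    (hσ : MeasurableFamily σ) (hτ : MeasurableFamily τ) (q : V) :
    Measurable fun ω => G.memValue (σ ω) (τ ω) q := by
  simp only [memValue_eq_iInf, expect_initConf]
  exact Measurable.iInf fun n => hσ.init _ fun _ => hσ.update _ _ _ fun _ =>
    hτ.init _ fun _ => hτ.update _ _ _ fun _ => G.measurable_surv hσ hτ n _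

end ConcurrentSafetyGame

/-! ### Mixtures and point masses of behavioural strategies. -/

/-- The general strategy that chooses the behavioural strategy `b T` with probability `p T`. -/
def GeneralStrategy.mixture {Sig Act : Type*} (p : PMF ℕ) (b : ℕ → BehaviouralStrategy Sig Act) :
    GeneralStrategy Sig Act :=
  ⟨p.toMeasure.map b,
    Measure.isProbabilityMeasure_map (measurable_from_top (f := b)).aemeasurable⟩

/-- A behavioural strategy, seen as a general strategy. -/
def GeneralStrategy.dirac {Sig Act : Type*} (b : BehaviouralStrategy Sig Act) :
    GeneralStrategy Sig Act :=
  ⟨Measure.dirac b, Measure.dirac.isProbabilityMeasure⟩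

theorem MeasureTheory.lintegral_dirac_le {α : Type*} [MeasurableSpace α] (f : α → ℝ≥0∞) (a : α) :
    ∫⁻ x, f x ∂Measure.dirac a ≤ f a := by
  obtain ⟨g, hg, hgf, h⟩ := exists_measurable_le_lintegral_eq (Measure.dirac a) f
  rw [h, lintegral_dirac' _ hg]
  exact hgf a

namespace ConcurrentSafetyGame

variable {V X Y Φ Ψ M N : Type*} (G : ConcurrentSafetyGame V X Y Φ Ψ)

/-! ### The layers -/

theorem almostPre_mono {W W' S S' : Set V} (hW : W ⊆ W') (hS : S ⊆ S') :
    G.almostPre W S ⊆ G.almostPre W' S' := by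
  rintro q ⟨B, hB⟩
  refine ⟨B, fun x => ⟨fun y hy r hr => hW ((hB x).1 y hy r hr), ?_⟩⟩
  obtain ⟨y, hy, r, hr, hrS⟩ := (hB x).2
  exact ⟨y, hy, r, hr, hS hrS⟩

theorem attractor_subset {W S : Set V} (h : G.safeᶜ ∪ G.almostPre W S ⊆ S) :
    G.attractor W ⊆ S :=
  Set.sInter_subset_of_mem h

theorem attractor_eq (W : Set V) :
    G.attractor W = G.safeᶜ ∪ G.almostPre W (G.attractor W) := by
  have h : G.safeᶜ ∪ G.almostPre W (G.attractor W) ⊆ G.attractor W :=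
    Set.subset_sInter fun S hS =>
      (Set.union_subset_union_right _ (G.almostPre_mono le_rfl (G.attractor_subset hS))).trans hS
  exact (G.attractor_subset
    (Set.union_subset_union_right _ (G.almostPre_mono le_rfl h))).antisymm h

theorem attractor_mono {W W' : Set V} (h : W ⊆ W') : G.attractor W ⊆ G.attractor W' := by
  refine G.attractor_subset ?_
  conv_rhs => rw [attractor_eq]
  exact Set.union_subset_union_right _ (G.almostPre_mono h le_rfl)

theorem layer_antitone : Antitone G.layer := by
  refine antitone_nat_of_succ_le fun n => ?_
  induction n with
  | zero => exact Set.subset_univ _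
  | succ n ih => exact G.attractor_mono ih

theorem exists_layer_succ_eq [Finite V] : ∃ n, G.layer (n + 1) = G.layer n := by
  by_contra! h
  exact not_strictAnti_of_wellFoundedLT G.layer
    (strictAnti_nat_of_succ_lt fun n => (G.layer_antitone n.le_succ).lt_of_ne (h n))

theorem mem_safe_of_notMem_layer {q : V} {n : ℕ} (h : q ∉ G.layer n) : q ∈ G.safe := by
  cases n with
  | zero => exact absurd (Set.mem_univ q) h
  | succ n =>
    by_contra hq
    refine h ?_
    change q ∈ G.attractor _
    rw [attractor_eq]
    exact Or.inl hq

/-- The actions of Adam that surely lead into `W`, whatever Eve plays. -/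
def confining (W : Set V) (q : V) : Set Y := {y | ∀ x, ∀ r ∈ (G.δ q x y).support, r ∈ W}

/-- The set `confining W q` is the largest choice of `B` that keeps the play in `W`, and enlarging
`B` only helps to reach `S`. -/
theorem mem_almostPre_iff [Nonempty X] {W S : Set V} {q : V} :
    q ∈ G.almostPre W S ↔
      ∀ x, ∃ y ∈ G.confining W q, ∃ r ∈ (G.δ q x y).support, r ∈ S := by
  constructor
  · rintro ⟨B, hB⟩ x
    obtain ⟨y, hy, h⟩ := (hB x).2
    exact ⟨y, fun x' => (hB x').1 y hy, h⟩
  · exact fun h => ⟨G.confining W q, fun x => ⟨fun y hy => hy x, h x⟩⟩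

theorem notMem_layer_of_prec {q r : V} {n : ℕ} (hq : q ∉ G.layer n) (h : G.prec q r) :
    r ∉ G.layer n := fun hr => hq (h n hr)

theorem prec_of_mem_layer {q r : V} {n : ℕ} (hq : q ∈ G.layer n) (hr : r ∉ G.layer (n + 1)) :
    G.prec q r := by
  intro i hi
  rcases Nat.lt_or_ge n i with h | h
  · exact absurd (G.layer_antitone h hi) hr
  · exact G.layer_antitone h hq

theorem notMem_layer_of_not_prec {q r : V} {n : ℕ} (hq : q ∉ G.layer (n + 1))
    (h : ¬ G.prec r q) : r ∉ G.layer n := by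
  intro hr
  exact h (G.prec_of_mem_layer hr hq)

/-- Consider the step at which `q` leaves the layers, from `layer n` to `layer (n + 1)`. Since `q`
is not in `almostPre`, some `x` keeps every confining action of Adam out of `layer (n + 1)`, hence
never leads to a lower class. A non-confining action leaves `layer n` against some action of Eve and
thus may lead to a higher class. -/
theorem exists_isSafeAction [Nonempty X] {q : V} {n : ℕ} (hq : q ∉ G.layer n) :
    ∃ x, G.IsSafeAction q x := by
  induction n with
  | zero => exact absurd (Set.mem_univ q) hq
  | succ n ih =>
    by_cases hn : q ∈ G.layer n
    · have hq' : q ∉ G.almostPre (G.layer n) (G.layer (n + 1)) := by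
        intro h
        refine hq ?_
        change q ∈ G.attractor _
        rw [attractor_eq]
        exact Or.inr h
      rw [mem_almostPre_iff] at hq'
      push Not at hq'
      obtain ⟨x, hx⟩ := hq'
      refine ⟨x, fun y => ?_⟩
      by_cases hy : y ∈ G.confining (G.layer n) q
      · exact Or.inl fun r hr => G.prec_of_mem_layer hn (hx y hy r hr)
      · right
        simp only [confining, Set.mem_ofPred_eq, not_forall] at hy
        obtain ⟨x', r, hr, hrn⟩ := hy
        exact ⟨x', r, hr, G.prec_of_mem_layer hn fun h => hrn (G.layer_antitone n.le_succ h),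
          fun h => hrn (h n hn)⟩
    · exact ih hn

/-! ### Adam wins almost surely from a fixpoint -/

section Adam

variable (σ : MemoryStrategy Φ X M) (τ : MemoryStrategy Ψ Y N)

theorem exists_surv_le [Finite X] [Nonempty X] {W : Set V} (hW : G.attractor W = W)
    {a : V → PMF Y} (ha : ∀ q, (G.confining W q).Nonempty → (a q).support = G.confining W q)
    {I : V → N → Prop} (hact : ∀ v n, I v n → τ.act (G.ψ (Sum.inl v)) n = a v)
    (hI : ∀ v n, I v n → ∀ y, ∀ n' ∈ (τ.update (G.ψ (Sum.inr y)) n).support,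
      ∀ r, ∀ n'' ∈ (τ.update (G.ψ (Sum.inl r)) n').support, I r n'')
    {q : V} (hq : q ∈ W) :
    ∃ k, ∃ ε < 1, ∀ c : Configuration V M N, c.vertex = q → I c.vertex c.memAdam →
      G.surv σ τ k c ≤ ε := by
  -- Least-fixpoint induction: this set contains the unsafe vertices and is closed under `almostPre
  -- W`. The invariant `I` says that Adam's memory identifies the current vertex.
  suffices h : G.attractor W ⊆ {q | ∃ k, ∃ ε < 1, ∀ c : Configuration V M N, c.vertex = q →
      I c.vertex c.memAdam → G.surv σ τ k c ≤ ε} from h (hW.symm ▸ hq)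
  refine G.attractor_subset ?_
  rintro q (hq | hq)
  · refine ⟨0, 0, one_pos, ?_⟩
    rintro c rfl -
    rw [G.surv_of_notMem σ τ hq]
  by_cases hsafe : q ∈ G.safe
  swap
  · refine ⟨0, 0, one_pos, ?_⟩
    rintro c rfl -
    rw [G.surv_of_notMem σ τ hsafe]
  rw [mem_almostPre_iff] at hq
  choose y hy r hr k ε hε hk using hq
  obtain ⟨x₁, hx₁⟩ := Finite.exists_max k
  -- Two nested uses of `PMF.expect_le_one_sub`: Adam draws `y x`, then the transition draws `r x`,
  -- from where the bound `ε x` applies.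
  let η (x : X) : ℝ≥0∞ := 1 - a q (y x) * (1 - (1 - G.δ q x (y x) (r x) * (1 - ε x)))
  have hη : ∀ x, η x < 1 := by
    intro x
    have h1 : a q (y x) ≠ 0 := by
      have : y x ∈ (a q).support := by rw [ha q ⟨_, hy x⟩]; exact hy x
      exact this
    have h2 : 1 - G.δ q x (y x) (r x) * (1 - ε x) < 1 :=
      ENNReal.sub_lt_self ENNReal.one_ne_top one_ne_zero
        (mul_ne_zero (hr x) (tsub_pos_of_lt (hε x)).ne')
    exact ENNReal.sub_lt_self ENNReal.one_ne_top one_ne_zero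
      (mul_ne_zero h1 (tsub_pos_of_lt h2).ne')
  obtain ⟨x₂, hx₂⟩ := Finite.exists_max η
  refine ⟨k x₁ + 1, η x₂, hη x₂, ?_⟩
  rintro c rfl hc
  rw [G.surv_succ σ τ hsafe, expect_step]
  refine PMF.expect_le_of_forall_le _ fun x _ => le_trans ?_ (hx₂ x)
  have hone : ∀ c', G.surv σ τ (k x₁) c' ≤ 1 := G.surv_le_one σ τ _
  rw [hact _ _ hc]
  refine PMF.expect_le_one_sub _ (fun y' => ?_) (a := y x) (PMF.expect_le_one_sub _ (fun v => ?_)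
    (a := r x) ?_)
  · exact PMF.expect_le_of_forall_le _ fun _ _ => PMF.expect_le_of_forall_le _ fun _ _ =>
      PMF.expect_le_of_forall_le _ fun _ _ => PMF.expect_le_of_forall_le _ fun _ _ =>
      PMF.expect_le_of_forall_le _ fun _ _ => hone _
  · exact PMF.expect_le_of_forall_le _ fun _ _ => PMF.expect_le_of_forall_le _ fun _ _ =>
      PMF.expect_le_of_forall_le _ fun _ _ => PMF.expect_le_of_forall_le _ fun _ _ => hone _
  · refine PMF.expect_le_of_forall_le _ fun _ _ => PMF.expect_le_of_forall_le _ fun _ _ =>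
      PMF.expect_le_of_forall_le _ fun n' hn' => PMF.expect_le_of_forall_le _ fun n'' hn'' => ?_
    exact (G.surv_antitone σ τ _ (hx₁ x)).trans (hk x _ rfl (hI _ _ hc _ _ hn' _ _ hn''))

theorem surv_add_le {C : Set (Configuration V M N)}
    (hC : ∀ c ∈ C, c.vertex ∈ G.safe → ∀ c' ∈ (G.step σ τ c).support, c' ∈ C)
    {m : ℕ} {ε : ℝ≥0∞} (hm : ∀ c ∈ C, G.surv σ τ m c ≤ ε) (k : ℕ) {c : Configuration V M N}
    (hc : c ∈ C) : G.surv σ τ (k + m) c ≤ G.surv σ τ k c * ε := by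
  induction k generalizing c with
  | zero =>
    by_cases hs : c.vertex ∈ G.safe
    · simpa [surv, hs] using hm c hc
    · simp [surv_of_notMem _ _ _ hs]
  | succ k ih =>
    by_cases hs : c.vertex ∈ G.safe
    · rw [show k + 1 + m = k + m + 1 by omega, surv_succ _ _ _ hs, surv_succ _ _ _ hs,
        ← PMF.expect_mul_const]
      exact PMF.expect_mono _ fun c' hc' => ih (hC c hc hs c' hc')
    · simp [surv_of_notMem _ _ _ hs]

theorem confValue_eq_zero_of_surv_le {C : Set (Configuration V M N)}
    (hC : ∀ c ∈ C, c.vertex ∈ G.safe → ∀ c' ∈ (G.step σ τ c).support, c' ∈ C)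
    {k : ℕ} {ε : ℝ≥0∞} (hε : ε < 1) (hk : ∀ c ∈ C, G.surv σ τ k c ≤ ε)
    {c : Configuration V M N} (hc : c ∈ C) : G.confValue σ τ c = 0 := by
  -- Each block of `k` steps starts in `C` again, so it costs Eve another factor `ε`.
  have h : ∀ j : ℕ, ∀ c ∈ C, G.surv σ τ (j * k) c ≤ ε ^ j := by
    intro j
    induction j with
    | zero => intro c _; simpa using G.surv_le_one σ τ 0 c
    | succ j ih =>
      intro c hc
      rw [Nat.succ_mul, pow_succ]
      exact (G.surv_add_le σ τ hC hk _ hc).trans (mul_le_mul_left (ih c hc) _)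
  refine le_antisymm (ge_of_tendsto' (ENNReal.tendsto_pow_atTop_nhds_zero_of_lt_one hε) fun j => ?_)
    zero_le
  exact (iInf_le _ _).trans (h j c hc)

theorem confValue_eq_zero [Finite V] [Finite X] [Nonempty X] {W : Set V}
    (hW : G.attractor W = W)
    {a : V → PMF Y} (ha : ∀ q, (G.confining W q).Nonempty → (a q).support = G.confining W q)
    {I : V → N → Prop} (hact : ∀ v n, I v n → τ.act (G.ψ (Sum.inl v)) n = a v)
    (hI : ∀ v n, I v n → ∀ y, ∀ n' ∈ (τ.update (G.ψ (Sum.inr y)) n).support,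
      ∀ r, ∀ n'' ∈ (τ.update (G.ψ (Sum.inl r)) n').support, I r n'')
    {c : Configuration V M N} (hc : c.vertex ∈ W) (hcI : I c.vertex c.memAdam) :
    G.confValue σ τ c = 0 := by
  have key : ∀ q : W, _ := fun q => G.exists_surv_le σ τ hW ha hact hI q.2
  choose k ε hε hk using key
  have : Nonempty W := ⟨⟨_, hc⟩⟩
  obtain ⟨q₁, h₁⟩ := Finite.exists_max k
  obtain ⟨q₂, h₂⟩ := Finite.exists_max ε
  refine G.confValue_eq_zero_of_surv_le σ τ
    (C := {c | c.vertex ∈ W ∧ I c.vertex c.memAdam}) ?_ (hε q₂) (k := k q₁) ?_ ⟨hc, hcI⟩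
  · rintro c ⟨hc, hcI⟩ hs c' hc'
    obtain ⟨x, -, y, hy, hv, -, hn⟩ := (G.mem_support_step σ τ).1 hc'
    rw [PMF.mem_support_bind_iff] at hn
    obtain ⟨n', hn', hn⟩ := hn
    refine ⟨?_, hI _ _ hcI _ _ hn' _ _ hn⟩
    -- A safe vertex of the fixpoint lies in `almostPre W W`, so confining actions exist and Adam
    -- draws from exactly these.
    rw [← hW, attractor_eq, hW] at hc
    obtain ⟨y₀, hy₀, -⟩ := (G.mem_almostPre_iff.1 (hc.resolve_left fun h => h hs)) x
    rw [hact _ _ hcI, ha _ ⟨y₀, hy₀⟩] at hy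
    exact hy x _ hv
  · rintro c ⟨hc, hcI⟩
    exact (G.surv_antitone σ τ c (h₁ ⟨_, hc⟩)).trans ((hk ⟨_, hc⟩ c rfl hcI).trans (h₂ _))

/-- With a single possible initial configuration, the infimum over horizons need not be exchanged
with the expectation. -/
theorem memValue_eq_zero_of_forall {q : V}
    (h : ∀ c ∈ (G.initConf σ τ q).support, G.confValue σ τ c = 0)
    (hfin : (G.initConf σ τ q).support.Subsingleton) : G.memValue σ τ q = 0 := by
  obtain ⟨c, hc⟩ := (G.initConf σ τ q).support_nonempty
  refine le_antisymm ?_ zero_le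
  rw [← h c hc, confValue]
  refine le_iInf fun n => (G.memValue_le_expect_surv σ τ q n).trans ?_
  exact PMF.expect_le_of_forall_le _ fun c' hc' => by rw [hfin hc' hc]

end Adam

/-- The behavioural strategy that plays according to the last signal only. -/
def lastSignalStrategy {Sig Act : Type*} (d : Sig) (a : Sig → PMF Act) :
    BehaviouralStrategy Sig Act := fun l => a (l.getLastD d)

theorem generalValue_dirac_eq_zero (σ : GeneralStrategy Φ X) {c : BehaviouralStrategy Ψ Y} {q : V}
    (h : ∀ b : BehaviouralStrategy Φ X,
      G.memValue b.toMemoryStrategy c.toMemoryStrategy q = 0) :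
    G.generalValue σ (GeneralStrategy.dirac c) q = 0 := by
  have hb : ∀ b : BehaviouralStrategy Φ X,
      ∫⁻ c', G.memValue b.toMemoryStrategy c'.toMemoryStrategy q
        ∂(GeneralStrategy.dirac c : Measure (BehaviouralStrategy Ψ Y)) = 0 :=
    fun b => le_antisymm ((lintegral_dirac_le _ c).trans_eq (h b)) zero_le
  simp only [generalValue, hb, lintegral_zero]

theorem notMem_layer_of_mem_positiveRegion [Finite V] [Finite X] [Nonempty X] [Finite Y]
    [Nonempty Y] {q : V} (hq : q ∈ G.positiveRegion) {n : ℕ}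
    (hn : G.layer (n + 1) = G.layer n) : q ∉ G.layer n := by
  intro hqn
  obtain ⟨σ, hσ⟩ := hq
  have hex : ∀ v, ∃ p : PMF Y, (G.confining (G.layer n) v).Nonempty →
      p.support = G.confining (G.layer n) v := by
    intro v
    by_cases h : (G.confining (G.layer n) v).Nonempty
    · exact (PMF.exists_support_eq h).imp fun p hp _ => hp
    · exact ⟨PMF.pure (Classical.arbitrary Y), fun h' => absurd h' h⟩
  choose a ha using hex
  have : Nonempty V := ⟨q⟩
  -- When Adam acts, his last signal is that of the current vertex, which he decodes by injectivity.
  -- The default signal is never used, since the initial vertex is observed before any action.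
  let c : BehaviouralStrategy Ψ Y := lastSignalStrategy (G.ψ (Sum.inl q)) fun s =>
    a (Function.invFun (fun v : V => G.ψ (Sum.inl v)) s)
  have hinv : ∀ v, Function.invFun (fun v : V => G.ψ (Sum.inl v)) (G.ψ (Sum.inl v)) = v :=
    Function.leftInverse_invFun G.ψ_injective
  have hzero : ∀ b : BehaviouralStrategy Φ X,
      G.memValue b.toMemoryStrategy c.toMemoryStrategy q = 0 := by
    intro b
    refine G.memValue_eq_zero_of_forall _ _ ?_ ?_
    · intro e he
      simp only [initConf, BehaviouralStrategy.toMemoryStrategy, PMF.pure_bind,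
        PMF.mem_support_pure_iff] at he
      subst he
      refine G.confValue_eq_zero _ _ hn ha
        (I := fun v l => ∃ l', l = l' ++ [G.ψ (Sum.inl v)]) ?_ ?_ hqn ⟨[], rfl⟩
      · rintro v _ ⟨l, rfl⟩
        simp [BehaviouralStrategy.toMemoryStrategy, c, lastSignalStrategy, hinv]
      · rintro v _ ⟨l, rfl⟩ y n' - r n'' hn''
        exact ⟨n', by simpa [BehaviouralStrategy.toMemoryStrategy] using hn''⟩
    · intro e he e' he'
      simp only [initConf, BehaviouralStrategy.toMemoryStrategy, PMF.pure_bind,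
        PMF.mem_support_pure_iff] at he he'
      rw [he, he']
  exact (hσ (GeneralStrategy.dirac c)).ne' (G.generalValue_dirac_eq_zero σ hzero)

/-! ### Eve's strategies -/

section Eve

variable (σ : MemoryStrategy Φ X M)

/-- Let `K v` be sets of memory states such that every state of `K r` can be reached from some state
of `K v` when the play rises from `v` to `r`, or when Eve plays the action `act v`, and such that
`K v` contains a state `s v` in which Eve plays `act v` and moves to `s r` if `r` is in the same
class as `v`. If all actions `act v` are safe, then some state in `K v` wins with positive
probability. -/
theorem exists_confValue_pos (τ : MemoryStrategy Ψ Y N) {act : V → X} {n : ℕ}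
    (hact : ∀ v ∉ G.layer n, G.IsSafeAction v (act v)) (K : V → Set M) (s : V → M)
    (hs : ∀ v, s v ∈ K v) (hs_act : ∀ v, σ.act (G.φ (Sum.inl v)) (s v) = PMF.pure (act v))
    (hs_update : ∀ v r, G.prec v r → G.prec r v →
      ∀ m ∈ ((σ.update (G.φ (Sum.inr (act v))) (s v)).bind (σ.update (G.φ (Sum.inl r)))).support,
        m = s r)
    (hK : ∀ v r x, (x = act v ∨ ¬ G.prec r v) → ∀ m' ∈ K r, ∃ m ∈ K v,
      x ∈ (σ.act (G.φ (Sum.inl v)) m).support ∧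
      m' ∈ ((σ.update (G.φ (Sum.inr x)) m).bind (σ.update (G.φ (Sum.inl r)))).support)
    {v : V} (hv : v ∉ G.layer n) (h : N) :
    ∃ m ∈ K v, 0 < G.confValue σ τ ⟨v, m, h⟩ := by
  -- The bound `j ≤ n` matters because the actions `act v` are safe only outside `layer n`.
  suffices H : ∀ j ≤ n, ∀ v ∉ G.layer j, ∀ h, ∃ m ∈ K v, 0 < G.confValue σ τ ⟨v, m, h⟩ from
    H n le_rfl v hv h
  clear hv h v
  intro j
  induction j with
  | zero => exact fun _ v hv => absurd (Set.mem_univ v) hv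
  | succ j ih =>
    intro hj v₀ hv₀ h₀
    have ih := ih (by omega)
    by_contra! hcon
    -- Eve is in the Sound state, but the value is assumed to vanish for every state of `K` she
    -- could have been in. This set turns out to be closed under steps.
    let R : Set (Configuration V M N) := {c | c.vertex ∉ G.layer (j + 1) ∧ c.memEve = s c.vertex ∧
      ∀ m ∈ K c.vertex, G.confValue σ τ ⟨c.vertex, m, c.memAdam⟩ = 0}
    have hsafe : ∀ c ∈ R, c.vertex ∈ G.safe := fun c hc => G.mem_safe_of_notMem_layer hc.1
    -- a successor that Eve can reach from a state of `K` has zero value in all states of `K`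
    have hback : ∀ c ∈ R, ∀ x r, (x = act c.vertex ∨ ¬ G.prec r c.vertex) →
        ∀ y ∈ (τ.act (G.ψ (Sum.inl c.vertex)) c.memAdam).support,
        r ∈ (G.δ c.vertex x y).support →
        ∀ h ∈ ((τ.update (G.ψ (Sum.inr y)) c.memAdam).bind
          (τ.update (G.ψ (Sum.inl r)))).support,
        ∀ m' ∈ K r, G.confValue σ τ ⟨r, m', h⟩ = 0 := by
      intro c hc x r hx y hy hr h hh m' hm'
      by_contra hne
      obtain ⟨m, hm, hxm, hmm⟩ := hK c.vertex r x hx m' hm'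
      refine (G.confValue_pos_of_step σ τ (c := ⟨c.vertex, m, c.memAdam⟩) (hsafe c hc) ?_
        (pos_iff_ne_zero.2 hne)).ne' (hc.2.2 m hm)
      exact (G.mem_support_step σ τ).2 ⟨x, hxm, y, hy, hr, hmm, hh⟩
    -- the play does not rise
    have hstay : ∀ c ∈ R, ∀ x r, (x = act c.vertex ∨ ¬ G.prec r c.vertex) →
        ∀ y ∈ (τ.act (G.ψ (Sum.inl c.vertex)) c.memAdam).support,
        r ∈ (G.δ c.vertex x y).support → r ∈ G.layer j := by
      intro c hc x r hx y hy hr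
      by_contra hrj
      obtain ⟨h, hh⟩ := ((τ.update (G.ψ (Sum.inr y)) c.memAdam).bind
          (τ.update (G.ψ (Sum.inl r)))).support_nonempty
      obtain ⟨m', hm', hpos⟩ := ih r hrj h
      exact hpos.ne' (hback c hc x r hx y hy hr h hh m' hm')
    have hclosed : ∀ c ∈ R, ∀ c' ∈ (G.step σ τ c).support, c' ∈ R := by
      intro c hc c' hc'
      have hc'' := hc
      obtain ⟨hcj, hcs, -⟩ := hc''
      obtain ⟨x, hx, y, hy, hr, hm, hh⟩ := (G.mem_support_step σ τ).1 hc'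
      rw [hcs, hs_act, PMF.mem_support_pure_iff] at hx
      subst hx
      have hprec : G.prec c.vertex c'.vertex := by
        -- The second alternative of safety would let the play rise out of `layer j` against `x'`,
        -- which `hstay` excludes.
        rcases hact c.vertex (fun h => hcj (G.layer_antitone hj h)) y with h | ⟨x', r, hr', -, hrc⟩
        · exact h _ hr
        · exact absurd (hstay c hc x' r (Or.inr hrc) y hy hr')
            (G.notMem_layer_of_not_prec hcj hrc)
      have hc'j := hstay c hc _ _ (Or.inl rfl) y hy hr
      refine ⟨G.notMem_layer_of_prec hcj hprec, ?_, ?_⟩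
      · rw [hcs] at hm
        exact hs_update _ _ hprec (G.prec_of_mem_layer hc'j hcj) _ hm
      · exact hback c hc _ _ (Or.inl rfl) y hy hr _ hh
    have hone : ∀ k, ∀ c ∈ R, G.surv σ τ k c = 1 := by
      intro k
      induction k with
      | zero => exact fun c hc => if_pos (hsafe c hc)
      | succ k ihk =>
        intro c hc
        rw [G.surv_succ σ τ (hsafe c hc), PMF.expect_congr _ (g := fun _ => 1) fun c' hc' =>
          ihk c' (hclosed c hc c' hc'), PMF.expect_const]
    have h₁ : G.confValue σ τ ⟨v₀, s v₀, h₀⟩ = 1 := by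
      have hR : (⟨v₀, s v₀, h₀⟩ : Configuration V M N) ∈ R :=
        ⟨hv₀, rfl, fun m hm => nonpos_iff_eq_zero.1 (hcon m hm)⟩
      simp [confValue, hone _ _ hR]
    exact (one_pos.trans_le h₁.ge).not_ge (hcon _ (hs v₀))

/-- A measurable function that is positive everywhere has positive integral, so Adam gains nothing
by randomising over behavioural strategies. -/
theorem isPositive_of_forall [Countable V] [Countable X] [Countable Y] [Countable M] {q : V}
    (h : ∀ c : BehaviouralStrategy Ψ Y, 0 < G.memValue σ c.toMemoryStrategy q) :
    G.IsPositive σ q := by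
  intro τ
  have hm : Measurable fun c : BehaviouralStrategy Ψ Y => G.memValue σ c.toMemoryStrategy q :=
    G.measurable_memValue (MeasurableFamily.const σ) (MeasurableFamily.behavioural measurable_id) q
  rw [lintegral_pos_iff_support hm]
  have : Function.support (fun c : BehaviouralStrategy Ψ Y =>
      G.memValue σ c.toMemoryStrategy q) = Set.univ := by
    ext c
    simpa using (h c).ne'
  simp [this]

end Eve

end ConcurrentSafetyGame

/-! ### Concrete strategies of Eve and the identification of the positive region. -/

/-- The behavioural strategy that a behavioural strategy with memory induces; `d` is the signal
that is used before any signal has been received. -/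
def BehaviouralMemoryStrategy.unroll {Sig Act Mem : Type*}
    (σ : BehaviouralMemoryStrategy Sig Act Mem) (d : Sig) : BehaviouralStrategy Sig Act :=
  fun l => σ.act (l.getLastD d) (l.foldl (fun m s => σ.update s m) σ.init)

theorem PMF.exists_support_eq_univ : ∃ p : PMF ℕ, p.support = Set.univ := by
  have h : ∑' n : ℕ, (2⁻¹ : ℝ≥0∞) ^ n = 2 := ENNReal.tsum_geometric_two
  refine ⟨PMF.normalize (fun n : ℕ => (2⁻¹ : ℝ≥0∞) ^ n) (by simp [h]) (by simp [h]), ?_⟩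
  ext n
  simp

instance (V : Type*) [Finite V] : Finite (SoundChanceMemory V) :=
  Finite.of_injective (fun m : SoundChanceMemory V => (m.sound, m.last, m.awaitVertex)) <| by
    rintro ⟨a, b, c⟩ ⟨a', b', c'⟩ h
    simpa using h

namespace ConcurrentSafetyGame

variable {V X Y Φ Ψ M N : Type*} (G : ConcurrentSafetyGame V X Y Φ Ψ)

/-- Deterministic updates make the memory a function of the signals. The list must end with the
signal of `v`, because `unroll` acts on its last entry. -/
theorem surv_unroll (σ : BehaviouralMemoryStrategy Φ X M) (d : Φ) (τ : MemoryStrategy Ψ Y N)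
    (n : ℕ) (v : V) (l : List Φ) (h : N) :
    G.surv (σ.unroll d).toMemoryStrategy τ n ⟨v, l ++ [G.φ (Sum.inl v)], h⟩ =
      G.surv σ.toMemoryStrategy τ n
        ⟨v, (l ++ [G.φ (Sum.inl v)]).foldl (fun m s => σ.update s m) σ.init, h⟩ := by
  induction n generalizing v l h with
  | zero => rfl
  | succ n ih =>
    by_cases hv : v ∈ G.safe
    · rw [surv_succ _ _ _ hv, surv_succ _ _ _ hv, expect_step, expect_step]
      simp only [BehaviouralStrategy.toMemoryStrategy, BehaviouralMemoryStrategy.toMemoryStrategy,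
        PMF.expect_pure] at ih ⊢
      simp only [ih]
      simp [BehaviouralMemoryStrategy.unroll]
    · rw [surv_of_notMem _ _ _ hv, surv_of_notMem _ _ _ hv]

theorem memValue_unroll (σ : BehaviouralMemoryStrategy Φ X M) (d : Φ) (τ : MemoryStrategy Ψ Y N)
    (q : V) :
    G.memValue (σ.unroll d).toMemoryStrategy τ q = G.memValue σ.toMemoryStrategy τ q := by
  rw [memValue_eq_iInf, memValue_eq_iInf]
  refine iInf_congr fun n => ?_
  rw [expect_initConf, expect_initConf]
  have h := G.surv_unroll σ d τ n q []
  simp only [BehaviouralStrategy.toMemoryStrategy, BehaviouralMemoryStrategy.toMemoryStrategy,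
    PMF.expect_pure] at h ⊢
  simp only [h]
  rfl

theorem vertexOf_signal [Nonempty V] (v : V) : G.vertexOf (G.φ (Sum.inl v)) = v :=
  Function.leftInverse_invFun G.φ_injective v

/-- The winning state in `K q` depends on Adam's strategy, but Eve draws every state of `K q` with
positive probability at the start. -/
theorem isPositive_of_notMem_layer [Countable V] [Countable X] [Countable Y] [Countable M]
    (σ : MemoryStrategy Φ X M) {act : V → X} {n : ℕ}
    (hact : ∀ v ∉ G.layer n, G.IsSafeAction v (act v)) (K : V → Set M) (s : V → M)
    (hs : ∀ v, s v ∈ K v) (hs_act : ∀ v, σ.act (G.φ (Sum.inl v)) (s v) = PMF.pure (act v))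
    (hs_update : ∀ v r, G.prec v r → G.prec r v →
      ∀ m ∈ ((σ.update (G.φ (Sum.inr (act v))) (s v)).bind (σ.update (G.φ (Sum.inl r)))).support,
        m = s r)
    (hK : ∀ v r x, (x = act v ∨ ¬ G.prec r v) → ∀ m' ∈ K r, ∃ m ∈ K v,
      x ∈ (σ.act (G.φ (Sum.inl v)) m).support ∧
      m' ∈ ((σ.update (G.φ (Sum.inr x)) m).bind (σ.update (G.φ (Sum.inl r)))).support)
    {q : V} (hq : q ∉ G.layer n)
    (hinit : ∀ m ∈ K q, m ∈ (σ.init.bind (σ.update (G.φ (Sum.inl q)))).support) :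
    G.IsPositive σ q := by
  refine G.isPositive_of_forall σ fun c => ?_
  obtain ⟨m, hm, hpos⟩ := G.exists_confValue_pos σ c.toMemoryStrategy hact K s hs hs_act hs_update
    hK hq [G.ψ (Sum.inl q)]
  refine G.memValue_pos_of_initConf _ _ (G.mem_support_initConf _ _ (hinit m hm) ?_) hpos
  simp [BehaviouralStrategy.toMemoryStrategy]

theorem isPositive_soundChance [Finite V] [Nonempty V] [Fintype X] [Nonempty X] [Finite Y]
    {act : V → X} {n : ℕ} (hact : ∀ v ∉ G.layer n, G.IsSafeAction v (act v)) {q : V}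
    (hq : q ∉ G.layer n) : G.IsPositive (G.soundChance act) q := by
  refine G.isPositive_of_notMem_layer _ hact (fun v => Set.range fun b => ⟨b, some v, false⟩)
    (fun v => ⟨true, some v, false⟩) (fun v => ⟨true, rfl⟩) ?_ ?_ ?_ hq ?_
  · intro v
    simp [soundChance, vertexOf_signal]
  · intro v r h₁ h₂ m hm
    simpa [soundChance, vertexOf_signal, h₁, h₂] using hm
  · rintro v r x hx _ ⟨b, rfl⟩
    -- Within a class the bit is kept, and both states may play `act v`. On a change of class the
    -- bit is redrawn, so Chance can play any action and still reach either bit.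
    by_cases hr : G.prec v r ∧ G.prec r v
    · obtain rfl : x = act v := hx.resolve_right fun h => h hr.2
      refine ⟨_, ⟨b, rfl⟩, ?_, ?_⟩
      · cases b <;> simp [soundChance, vertexOf_signal]
      · simp [soundChance, vertexOf_signal, hr]
    · refine ⟨_, ⟨false, rfl⟩, ?_, ?_⟩
      · simp [soundChance]
      · simp [soundChance, vertexOf_signal, hr]
  · rintro _ ⟨b, rfl⟩
    simp [soundChance, vertexOf_signal]

/-- The strategy with two memory states that starts in the state `0` (Sound) or `1` (Chance) and
switches from Chance to Sound at a random time. -/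
def switchToSound [Nonempty V] [Fintype X] [Nonempty X] (act : V → X) :
    MemoryStrategy Φ X (Fin 2) where
  init := PMF.uniformOfFintype (Fin 2)
  update _ m := if m = 0 then PMF.pure 0 else PMF.uniformOfFintype (Fin 2)
  act s m := if m = 0 then PMF.pure (act (G.vertexOf s)) else PMF.uniformOfFintype X

theorem isPositive_switchToSound [Finite V] [Nonempty V] [Fintype X] [Nonempty X] [Finite Y]
    {act : V → X} {n : ℕ} (hact : ∀ v ∉ G.layer n, G.IsSafeAction v (act v)) {q : V}
    (hq : q ∉ G.layer n) : G.IsPositive (G.switchToSound act) q := by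
  refine G.isPositive_of_notMem_layer _ hact (fun _ => Set.univ) (fun _ => 0)
    (fun _ => Set.mem_univ _) ?_ ?_ ?_ hq ?_
  · intro v
    simp [switchToSound, vertexOf_signal]
  · intro v r _ _ m hm
    simpa [switchToSound] using hm
  -- The Chance state `1` plays every action and may move to either state, so it precedes
  -- everything.
  · intro v r x _ m _
    refine ⟨1, Set.mem_univ _, ?_, ?_⟩
    · simp [switchToSound]
    · rw [PMF.mem_support_bind_iff]
      exact ⟨1, by simp [switchToSound], by simp [switchToSound]⟩
  · intro m _
    rw [PMF.mem_support_bind_iff]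
    exact ⟨1, by simp [switchToSound], by simp [switchToSound]⟩

/-- The strategy that plays all actions with equal probabilities until `T` signals have been
received, and the actions `act` afterwards. -/
def countdown [Nonempty V] [Fintype X] [Nonempty X] (act : V → X) (T : ℕ) :
    BehaviouralMemoryStrategy Φ X ℕ where
  init := T
  update _ m := m - 1
  act s m := if m = 0 then PMF.pure (act (G.vertexOf s)) else PMF.uniformOfFintype X

theorem exists_memValue_countdown_pos [Nonempty V] [Fintype X] [Nonempty X]
    {act : V → X} {n : ℕ} (hact : ∀ v ∉ G.layer n, G.IsSafeAction v (act v)) {q : V}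
    (hq : q ∉ G.layer n) (τ : MemoryStrategy Ψ Y N) :
    ∃ T, 0 < G.memValue (G.countdown act T).toMemoryStrategy τ q := by
  obtain ⟨h, hh⟩ := (τ.init.bind (τ.update (G.ψ (Sum.inl q)))).support_nonempty
  obtain ⟨T, -, hT⟩ := G.exists_confValue_pos (G.countdown act 0).toMemoryStrategy τ hact
    (fun _ => Set.univ) (fun _ => 0) (fun _ => Set.mem_univ _) (fun v => by
      simp [BehaviouralMemoryStrategy.toMemoryStrategy, countdown, vertexOf_signal])
    (fun v r _ _ m hm => by
      simpa [BehaviouralMemoryStrategy.toMemoryStrategy, countdown] using hm)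
    -- Each round delivers two signals, the action and the next vertex, so the counter drops by two.
    (fun v r x _ m _ => ⟨m + 2, Set.mem_univ _, by
      simp [BehaviouralMemoryStrategy.toMemoryStrategy, countdown], by
      simp [BehaviouralMemoryStrategy.toMemoryStrategy, countdown]⟩) hq h
  -- The signal of the initial vertex already decrements the counter once. Countdown strategies
  -- differ only in their initial memory, which `surv` ignores.
  refine ⟨T + 1, G.memValue_pos_of_initConf _ _ (c := ⟨q, T, h⟩)
    (G.mem_support_initConf _ _ ?_ hh) (hT.trans_eq ?_)⟩
  · simp [BehaviouralMemoryStrategy.toMemoryStrategy, countdown]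
  · have : ∀ k c, G.surv (G.countdown act 0).toMemoryStrategy τ k c =
        G.surv (G.countdown act (T + 1)).toMemoryStrategy τ k c := by
      intro k
      induction k with
      | zero => intro c; rfl
      | succ k ih =>
        intro c
        by_cases hc : c.vertex ∈ G.safe
        · rw [surv_succ _ _ _ hc, surv_succ _ _ _ hc, funext ih]
          rfl
        · rw [surv_of_notMem _ _ _ hc, surv_of_notMem _ _ _ hc]
    exact iInf_congr fun k => this k _

theorem measurable_lintegral_memValue [Countable V] [Countable X] [Countable Y]
    (τ : GeneralStrategy Ψ Y) (q : V) :
    Measurable fun b : BehaviouralStrategy Φ X =>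
      ∫⁻ c, G.memValue b.toMemoryStrategy c.toMemoryStrategy q
        ∂(τ : Measure (BehaviouralStrategy Ψ Y)) :=
  Measurable.lintegral_prod_right' (f := fun p : BehaviouralStrategy Φ X × BehaviouralStrategy Ψ Y =>
    G.memValue p.1.toMemoryStrategy p.2.toMemoryStrategy q)
    (G.measurable_memValue (MeasurableFamily.behavioural measurable_fst)
      (MeasurableFamily.behavioural measurable_snd) q)

theorem mem_positiveRegion_of_isPositive [Countable V] [Countable X] [Countable Y]
    {b : BehaviouralStrategy Φ X} {q : V} (h : G.IsPositive b.toMemoryStrategy q) :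
    q ∈ G.positiveRegion := by
  refine ⟨GeneralStrategy.dirac b, fun τ => ?_⟩
  rw [generalValue]
  exact (h τ).trans_eq (lintegral_dirac' b (G.measurable_lintegral_memValue τ q)).symm

/-- Eve draws the switching time `T` from a distribution that charges all of `ℕ`. If her value were
zero, almost every strategy of Adam would beat all the countably many countdowns at once, whereas
each one loses to some countdown. -/
theorem mem_positiveRegion_of_notMem_layer [Finite V] [Finite X] [Nonempty X] [Finite Y]
    {q : V} {n : ℕ} (hq : q ∉ G.layer n) : q ∈ G.positiveRegion := by
  have := Fintype.ofFinite X
  have : Nonempty V := ⟨q⟩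
  have hex : ∀ v, ∃ x, v ∉ G.layer n → G.IsSafeAction v x := by
    intro v
    by_cases hv : v ∈ G.layer n
    · exact ⟨Classical.arbitrary X, fun h => absurd hv h⟩
    · exact (G.exists_isSafeAction hv).imp fun x hx _ => hx
  choose act hact using hex
  obtain ⟨p, hp⟩ := PMF.exists_support_eq_univ
  let b (T : ℕ) : BehaviouralStrategy Φ X := (G.countdown act T).unroll (G.φ (Sum.inl q))
  have hb : Measurable b := measurable_from_top
  refine ⟨GeneralStrategy.mixture p b, fun τ => ?_⟩
  rw [pos_iff_ne_zero]
  intro h0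
  have hg := G.measurable_lintegral_memValue τ q
  have hmix : (GeneralStrategy.mixture p b : Measure (BehaviouralStrategy Φ X)) =
      p.toMeasure.map b := rfl
  rw [generalValue, hmix, lintegral_map hg hb, PMF.lintegral_toMeasure _ measurable_from_top] at h0
  have hT : ∀ T, ∀ᵐ c ∂(τ : Measure (BehaviouralStrategy Ψ Y)),
      G.memValue (b T).toMemoryStrategy c.toMemoryStrategy q = 0 := by
    intro T
    have h1 := ENNReal.tsum_eq_zero.1 h0 T
    have h2 : p T ≠ 0 := by
      rw [← PMF.mem_support_iff, hp]
      trivial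
    exact (lintegral_eq_zero_iff (G.measurable_memValue
      (MeasurableFamily.behavioural measurable_const)
      (MeasurableFamily.behavioural measurable_id) q)).1 ((mul_eq_zero.1 h1).resolve_left h2)
  obtain ⟨c, hc⟩ := (ae_all_iff.2 hT).exists
  obtain ⟨T, hpos⟩ := G.exists_memValue_countdown_pos (fun v hv => hact v hv) hq
    c.toMemoryStrategy
  rw [← G.memValue_unroll _ (G.φ (Sum.inl q))] at hpos
  exact hpos.ne' (hc T)

theorem exists_positiveRegion_eq [Finite V] [Finite X] [Nonempty X] [Finite Y] [Nonempty Y] :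
    ∃ n, G.positiveRegion = (G.layer n)ᶜ := by
  obtain ⟨n, hn⟩ := G.exists_layer_succ_eq
  exact ⟨n, Set.Subset.antisymm (fun q hq => G.notMem_layer_of_mem_positiveRegion hq hn)
    fun q hq => G.mem_positiveRegion_of_notMem_layer hq⟩

end ConcurrentSafetyGame

theorem PMF.expect_bool (p : PMF Bool) (f : Bool → ℝ≥0∞) :
    p.expect f = p false * f false + p true * f true := by
  rw [PMF.expect, tsum_fintype, Fintype.sum_bool, add_comm]

theorem PMF.apply_false_add_apply_true (p : PMF Bool) : p false + p true = 1 := by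
  simpa [PMF.expect_bool] using p.expect_const 1

/-! ### A game that needs infinite memory

At the vertex `none`, Adam hides (`false`) or runs (`true`), and Eve waits (`false`) or throws
(`true`). If Eve waits while Adam hides, the play stays at `none`. Eve wins if she throws at the
moment when Adam runs, and loses otherwise. -/

namespace HideOrRun

open ConcurrentSafetyGame

/-- The next vertex: `some true` is won by Eve, `some false` is lost. -/
def next : Option Bool → Bool → Bool → Option Bool
  | some b, _, _ => some b
  | none, true, y => some y
  | none, false, true => some false
  | none, false, false => none

/-- The game in which all actions are observed by the player who plays them. -/
def game : ConcurrentSafetyGame (Option Bool) Bool Bool (Option Bool ⊕ Bool)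
    (Option Bool ⊕ Bool) where
  δ v x y := PMF.pure (next v x y)
  φ := id
  ψ := id
  φ_injective := Sum.inl_injective
  ψ_injective := Sum.inl_injective
  safe := {some false}ᶜ

variable {M N : Type*}

theorem confValue_won (σ : MemoryStrategy (Option Bool ⊕ Bool) Bool M)
    (τ : MemoryStrategy (Option Bool ⊕ Bool) Bool N) (m : M) (h : N) :
    game.confValue σ τ ⟨some true, m, h⟩ = 1 := by
  have hs : ∀ n m h, game.surv σ τ n ⟨some true, m, h⟩ = 1 := by
    intro n
    induction n with
    | zero => intro m h; simp [surv, game]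
    | succ n ih =>
      intro m h
      rw [surv_succ _ _ _ (by simp [game]), expect_step]
      simp only [game, next, PMF.expect_pure] at ih ⊢
      simp only [ih, PMF.expect_const]
  simp [confValue, hs]

theorem surv_lost (σ : MemoryStrategy (Option Bool ⊕ Bool) Bool M)
    (τ : MemoryStrategy (Option Bool ⊕ Bool) Bool N) (n : ℕ) (m : M) (h : N) :
    game.surv σ τ n ⟨some false, m, h⟩ = 0 :=
  game.surv_of_notMem σ τ (by simp [game]) n

/-! #### A positive behavioural strategy -/

/-- The probability with which Eve throws after `m` signals. -/
def throwProb (m : ℕ) : NNReal := 2⁻¹ ^ (m + 2)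

theorem throwProb_le_one (m : ℕ) : throwProb m ≤ 1 :=
  pow_le_one₀ zero_le (by norm_num)

/-- Eve's action after `m` signals. -/
def throwDist (m : ℕ) : PMF Bool :=
  PMF.ofFintype (fun b => cond b (throwProb m : ℝ≥0∞) (1 - throwProb m)) <| by
    have h : (throwProb m : ℝ≥0∞) ≤ 1 := by exact_mod_cast throwProb_le_one m
    simp [add_tsub_cancel_of_le h]

/-- Eve counts the signals and throws with summable probabilities. -/
def decreasingThrows : BehaviouralMemoryStrategy (Option Bool ⊕ Bool) Bool ℕ where
  init := 0
  update _ m := m + 1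
  act _ m := throwDist m

/-- One round of the bound that, after `m` signals, Eve never throws with probability at least `1 -
2 * throwProb m`. A round takes two signals, so the throwing probability is divided by four. -/
theorem one_sub_two_mul_throwProb_le (m : ℕ) :
    1 - 2 * (throwProb m : ℝ≥0∞) ≤
      (1 - (throwProb m : ℝ≥0∞)) * (1 - 2 * (throwProb (m + 2) : ℝ≥0∞)) := by
  have h4 : throwProb (m + 2) = throwProb m / 4 := by
    rw [throwProb, throwProb, pow_add _ (m + 2) 2]
    norm_num [div_eq_mul_inv]
  have h : 1 - 2 * throwProb m ≤ (1 - throwProb m) * (1 - 2 * throwProb (m + 2)) := by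
    rw [h4]
    have h1 := throwProb_le_one m
    generalize throwProb m = a at h1
    have h2 : 2 * (a / 4) ≤ 1 := by
      rw [← NNReal.coe_le_coe] at h1 ⊢
      push_cast at h1 ⊢
      linarith
    rw [tsub_le_iff_right, ← NNReal.coe_le_coe]
    rw [← NNReal.coe_le_coe] at h1
    push_cast [NNReal.coe_sub h2, NNReal.coe_sub (NNReal.coe_le_coe.1 h1)] at h1 ⊢
    nlinarith [a.2, mul_nonneg a.2 a.2]
  exact_mod_cast h

theorem confValue_decreasingThrows_pos
    (τ : MemoryStrategy (Option Bool ⊕ Bool) Bool N) (m : ℕ) (h : N) :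
    0 < game.confValue decreasingThrows.toMemoryStrategy τ ⟨none, m, h⟩ := by
  set σ := decreasingThrows.toMemoryStrategy with hσ
  by_contra hcon
  -- Value zero passes to every possible successor at `none`. On `R` Adam cannot run, since Eve
  -- might throw at that moment; he therefore hides, and Eve survives by never throwing.
  let R : Set (Configuration (Option Bool) ℕ N) :=
    {c | c.vertex = none ∧ game.confValue σ τ c = 0}
  have hact : ∀ m x, x ∈ (σ.act (Sum.inl none) m).support := by
    intro m x
    have h0 : throwProb m ≠ 0 := by simp [throwProb]
    have h1 : throwProb m < 1 := pow_lt_one₀ zero_le (inv_lt_one_of_one_lt₀ (by norm_num)) (by simp)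
    have h2 : (1 : ℝ≥0∞) - throwProb m ≠ 0 := (tsub_pos_of_lt (by exact_mod_cast h1)).ne'
    cases x
    · simpa [hσ, decreasingThrows, BehaviouralMemoryStrategy.toMemoryStrategy, throwDist] using h2
    · simpa [hσ, decreasingThrows, BehaviouralMemoryStrategy.toMemoryStrategy, throwDist] using h0
  have hstep : ∀ c ∈ R, ∀ c' ∈ (game.step σ τ c).support,
      c'.vertex = none → c' ∈ R ∧ c'.memEve = c.memEve + 2 := by
    rintro c ⟨hc, hc0⟩ c' hc' hv
    refine ⟨⟨hv, ?_⟩, ?_⟩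
    · by_contra hne
      exact (game.confValue_pos_of_step σ τ (by simp [hc, game]) hc' (pos_iff_ne_zero.2 hne)).ne'
        hc0
    · obtain ⟨x, -, y, -, -, hm, -⟩ := (game.mem_support_step σ τ).1 hc'
      simpa [hσ, decreasingThrows, BehaviouralMemoryStrategy.toMemoryStrategy] using hm
  have hhide : ∀ c ∈ R, ∀ y ∈ (τ.act (Sum.inl none) c.memAdam).support, y = false := by
    rintro c ⟨hc, hc0⟩ y hy
    by_contra hne
    obtain rfl : y = true := by simpa using hne
    obtain ⟨m', hm'⟩ := ((σ.update (Sum.inr true) c.memEve).bind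
      (σ.update (Sum.inl (some true)))).support_nonempty
    obtain ⟨h', hh'⟩ := ((τ.update (Sum.inr true) c.memAdam).bind
      (τ.update (Sum.inl (some true)))).support_nonempty
    refine (game.confValue_pos_of_step σ τ (c := c) (c' := ⟨some true, m', h'⟩)
      (by simp [hc, game]) ?_ ?_).ne' hc0
    · refine (game.mem_support_step σ τ).2 ⟨true, ?_, true, ?_, ?_, hm', hh'⟩
      · rw [hc]; exact hact _ _
      · rw [hc]; exact hy
      · simp [hc, game, next]
    · rw [confValue_won]; exact one_pos
  have hlow : ∀ n, ∀ c ∈ R, 1 - 2 * (throwProb c.memEve : ℝ≥0∞) ≤ game.surv σ τ n c := by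
    intro n
    induction n with
    | zero =>
      rintro c ⟨hc, -⟩
      simp [surv, game, hc]
    | succ n ih =>
      intro c hc
      have hc1 := hc.1
      rw [surv_succ _ _ _ (by simp [hc1, game])]
      calc 1 - 2 * (throwProb c.memEve : ℝ≥0∞)
          ≤ _ := one_sub_two_mul_throwProb_le _
        _ ≤ (game.step σ τ c).expect fun c' =>
            if c'.vertex = none then 1 - 2 * (throwProb (c.memEve + 2) : ℝ≥0∞) else 0 := by
          rw [expect_step, hc1, PMF.expect_bool]
          -- Only the branch in which Eve waits is kept.
          refine le_trans ?_ le_self_add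
          refine mul_le_mul' (by simp [hσ, decreasingThrows,
            BehaviouralMemoryStrategy.toMemoryStrategy, throwDist]) ?_
          rw [PMF.expect_congr (g := fun _ => 1 - 2 * (throwProb (c.memEve + 2) : ℝ≥0∞)),
            PMF.expect_const]
          intro y hy
          rw [hhide c hc y hy]
          simp [game, next, PMF.expect_pure, PMF.expect_const]
        _ ≤ _ := by
          refine PMF.expect_mono _ fun c' hc' => ?_
          split_ifs with hv
          · obtain ⟨hR, hm⟩ := hstep c hc c' hc' hv
            rw [← hm]
            exact ih c' hR
          · exact zero_le
  have hpos : 0 < 1 - 2 * (throwProb m : ℝ≥0∞) := by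
    have : 2 * throwProb m < 1 := by
      have h : throwProb m ≤ 2⁻¹ ^ 2 :=
        pow_le_pow_of_le_one zero_le (inv_lt_one_of_one_lt₀ (by norm_num)).le (by omega)
      rw [← NNReal.coe_le_coe] at h
      rw [← NNReal.coe_lt_coe]
      push_cast at h ⊢
      linarith
    exact tsub_pos_of_lt (by exact_mod_cast this)
  exact hcon (hpos.trans_le (le_iInf fun n =>
    hlow n ⟨none, m, h⟩ ⟨rfl, nonpos_iff_eq_zero.1 (not_lt.1 hcon)⟩))

theorem exists_isPositive :
    ∃ b : BehaviouralStrategy (Option Bool ⊕ Bool) Bool,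
      game.IsPositive b.toMemoryStrategy none := by
  refine ⟨decreasingThrows.unroll (Sum.inl none), game.isPositive_of_forall _ fun c => ?_⟩
  rw [memValue_unroll]
  refine game.memValue_pos_of_initConf _ _ (game.mem_support_initConf _ _ (m := 1)
    (n := [Sum.inl none]) ?_ ?_) (confValue_decreasingThrows_pos _ _ _)
  · simp [decreasingThrows, BehaviouralMemoryStrategy.toMemoryStrategy]
  · simp [BehaviouralStrategy.toMemoryStrategy, game]

/-! #### Finite memory does not suffice -/

section FiniteMemory

variable (σ : BehaviouralMemoryStrategy (Option Bool ⊕ Bool) Bool M)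
  (c : BehaviouralStrategy (Option Bool ⊕ Bool) Bool)

/-- The memory update while Eve waits and Adam hides. -/
def waitUpdate (m : M) : M := σ.update (Sum.inl none) (σ.update (Sum.inr false) m)

theorem surv_succ_of_hide {l : List (Option Bool ⊕ Bool)} (hl : c l = PMF.pure false) (n : ℕ)
    (m : M) :
    game.surv σ.toMemoryStrategy c.toMemoryStrategy (n + 1) ⟨none, m, l⟩ =
      σ.act (Sum.inl none) m false * game.surv σ.toMemoryStrategy c.toMemoryStrategy n
        ⟨none, waitUpdate σ m, l ++ [Sum.inr false] ++ [Sum.inl none]⟩ := by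
  rw [surv_succ _ _ _ (by simp [game]), expect_step, PMF.expect_bool]
  have h := surv_lost σ.toMemoryStrategy c.toMemoryStrategy n
  simp only [BehaviouralMemoryStrategy.toMemoryStrategy, BehaviouralStrategy.toMemoryStrategy,
    PMF.expect_pure, hl, game, next, id_eq] at h ⊢
  simp only [h, mul_zero, add_zero]
  rfl

theorem surv_one_of_run {l : List (Option Bool ⊕ Bool)} (hl : c l = PMF.pure true)
    {m : M} (hm : σ.act (Sum.inl none) m true = 0) :
    game.surv σ.toMemoryStrategy c.toMemoryStrategy 1 ⟨none, m, l⟩ = 0 := by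
  rw [surv_succ _ _ _ (by simp [game]), expect_step, PMF.expect_bool]
  have h := surv_lost σ.toMemoryStrategy c.toMemoryStrategy 0
  simp only [BehaviouralMemoryStrategy.toMemoryStrategy, BehaviouralStrategy.toMemoryStrategy,
    PMF.expect_pure, hl, game, next, id_eq] at h hm ⊢
  simp only [h, hm, mul_zero, add_zero, zero_mul]

theorem memValue_le_surv (n : ℕ) :
    game.memValue σ.toMemoryStrategy c.toMemoryStrategy none ≤
      game.surv σ.toMemoryStrategy c.toMemoryStrategy n
        ⟨none, σ.update (Sum.inl none) σ.init, [Sum.inl none]⟩ := by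
  refine (game.memValue_le_expect_surv _ _ none n).trans_eq ?_
  rw [expect_initConf]
  simp only [BehaviouralMemoryStrategy.toMemoryStrategy, BehaviouralStrategy.toMemoryStrategy,
    PMF.expect_pure]
  rfl

/-- Adam hides until `2 * k` signals have been received, and runs afterwards. -/
def runAfter (k : ℕ) : BehaviouralStrategy (Option Bool ⊕ Bool) Bool :=
  fun l => PMF.pure (decide (2 * k < l.length))

/-- If Eve surely waits at some time, Adam wins by running at that time. -/
theorem exists_memValue_eq_zero_of_wait {k : ℕ}
    (hk : σ.act (Sum.inl none) ((waitUpdate σ)^[k] (σ.update (Sum.inl none) σ.init)) true = 0) :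
    ∃ c : BehaviouralStrategy (Option Bool ⊕ Bool) Bool,
      game.memValue σ.toMemoryStrategy c.toMemoryStrategy none = 0 := by
  refine ⟨runAfter k, nonpos_iff_eq_zero.1 ?_⟩
  refine (memValue_le_surv σ _ (k + 1)).trans_eq ?_
  -- In round `i` Adam has received `2 * i + 1` signals, so `runAfter k` first runs in round `k`. A
  -- throw in an earlier round meets a hiding Adam and loses.
  have key : ∀ n i (l : List (Option Bool ⊕ Bool)), i + n = k → l.length = 2 * i + 1 →
      game.surv σ.toMemoryStrategy (runAfter k).toMemoryStrategy (n + 1)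
        ⟨none, (waitUpdate σ)^[i] (σ.update (Sum.inl none) σ.init), l⟩ = 0 := by
    intro n
    induction n with
    | zero =>
      intro i l hi hl
      obtain rfl : i = k := by omega
      exact surv_one_of_run σ _ (by simp [runAfter, hl]) hk
    | succ n ih =>
      intro i l hi hl
      rw [surv_succ_of_hide σ _ (by rw [runAfter, decide_eq_false (by omega)]),
        ← Function.iterate_succ_apply' (waitUpdate σ), ih (i + 1) _ (by omega) (by simp [hl]; omega),
        mul_zero]
  exact key k 0 _ (by omega) rfl

/-- If Eve throws from some memory state infinitely often, Adam wins by hiding forever. -/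
theorem exists_memValue_eq_zero_of_infinite {m : M} (hm : σ.act (Sum.inl none) m true ≠ 0)
    (hinf : ∀ k, ∃ i ≥ k, (waitUpdate σ)^[i] (σ.update (Sum.inl none) σ.init) = m) :
    ∃ c : BehaviouralStrategy (Option Bool ⊕ Bool) Bool,
      game.memValue σ.toMemoryStrategy c.toMemoryStrategy none = 0 := by
  refine ⟨fun _ => PMF.pure false, ?_⟩
  set c : BehaviouralStrategy (Option Bool ⊕ Bool) Bool := fun _ => PMF.pure false
  set m₀ := σ.update (Sum.inl none) σ.init
  set ε := σ.act (Sum.inl none) m false with hε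
  have hε1 : ε < 1 := by
    rw [← (σ.act (Sum.inl none) m).apply_false_add_apply_true]
    exact ENNReal.lt_add_right (PMF.apply_ne_top _ _) hm
  -- Rounds between two visits to `m` can only lower the survival probability; each visit to `m`
  -- contributes a factor `ε`.
  have hwait : ∀ d n i (b : ℝ≥0∞), (∀ l, game.surv σ.toMemoryStrategy c.toMemoryStrategy n
        ⟨none, (waitUpdate σ)^[i + d] m₀, l⟩ ≤ b) →
      ∀ l, game.surv σ.toMemoryStrategy c.toMemoryStrategy (n + d)
        ⟨none, (waitUpdate σ)^[i] m₀, l⟩ ≤ b := by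
    intro d
    induction d with
    | zero => exact fun n i b h => h
    | succ d ih =>
      intro n i b h l
      rw [← add_assoc, surv_succ_of_hide σ c rfl, ← Function.iterate_succ_apply' (waitUpdate σ)]
      refine (mul_le_of_le_one_left zero_le (PMF.coe_le_one _ _)).trans (ih n (i + 1) b ?_ _)
      rwa [show i + 1 + d = i + (d + 1) by omega]
  have key : ∀ j i, ∃ n, ∀ l, game.surv σ.toMemoryStrategy c.toMemoryStrategy n
      ⟨none, (waitUpdate σ)^[i] m₀, l⟩ ≤ ε ^ j := by
    intro j
    induction j with
    | zero => exact fun i => ⟨0, fun l => by simpa using game.surv_le_one _ _ 0 _⟩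
    | succ j ih =>
      intro i
      obtain ⟨i', hi', him⟩ := hinf i
      obtain ⟨n, hn⟩ := ih (i' + 1)
      refine ⟨n + 1 + (i' - i), hwait (i' - i) (n + 1) i _ fun l => ?_⟩
      rw [show i + (i' - i) = i' by omega, surv_succ_of_hide σ c rfl,
        ← Function.iterate_succ_apply' (waitUpdate σ), him, pow_succ']
      exact mul_le_mul_right (hn _) _
  refine le_antisymm (ge_of_tendsto' (ENNReal.tendsto_pow_atTop_nhds_zero_of_lt_one hε1)
    fun j => ?_) zero_le
  obtain ⟨n, hn⟩ := key j 0
  exact (memValue_le_surv σ c n).trans (hn _)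

theorem not_isPositive [Finite M] : ¬ game.IsPositive σ.toMemoryStrategy none := by
  suffices h : ∃ c : BehaviouralStrategy (Option Bool ⊕ Bool) Bool,
      game.memValue σ.toMemoryStrategy c.toMemoryStrategy none = 0 by
    obtain ⟨c, hc⟩ := h
    intro hpos
    refine (hpos (GeneralStrategy.dirac c)).not_ge ?_
    exact (lintegral_dirac_le (fun c : BehaviouralStrategy (Option Bool ⊕ Bool) Bool =>
      game.memValue σ.toMemoryStrategy c.toMemoryStrategy none) c).trans_eq hc
  by_cases h : ∃ k, σ.act (Sum.inl none)
      ((waitUpdate σ)^[k] (σ.update (Sum.inl none) σ.init)) true = 0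
  · obtain ⟨k, hk⟩ := h
    exact exists_memValue_eq_zero_of_wait σ hk
  · push Not at h
    -- While Eve waits and Adam hides, the memory evolves deterministically, so by the pigeonhole
    -- principle some state recurs infinitely often.
    obtain ⟨m, hm⟩ := Finite.exists_infinite_fiber
      fun k => (waitUpdate σ)^[k] (σ.update (Sum.inl none) σ.init)
    rw [Set.infinite_coe_iff] at hm
    obtain ⟨k, hk⟩ := hm.nonempty
    refine exists_memValue_eq_zero_of_infinite σ (m := m) ?_ fun k => ?_
    · rw [← show _ = m from hk]
      exact h k
    · obtain ⟨i, hi, hki⟩ := hm.exists_gt k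
      exact ⟨i, hki.le, hi⟩

end FiniteMemory

end HideOrRun

end

theorem mainTheorem1 :
    (∀ (V X Y Φ Ψ : Type*) [Finite V] [Fintype X] [Finite Y] [Nonempty V] [Nonempty X] [Nonempty Y]
      (G : ConcurrentSafetyGame V X Y Φ Ψ),
      (∃ σ : MemoryStrategy Φ X (Fin 2), ∀ q ∈ G.positiveRegion, G.IsPositive σ q) ∧
      (∀ q ∈ G.positiveRegion, ∃ x : X, G.IsSafeAction q x) ∧
      (∀ act : V → X, (∀ q ∈ G.positiveRegion, G.IsSafeAction q (act q)) →
        ∀ q ∈ G.positiveRegion, G.IsPositive (G.soundChance act) q)) ∧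
    (∃ (V X Y Φ Ψ : Type) (_ : Finite V) (_ : Finite X) (_ : Finite Y) (_ : Finite Φ) (_ : Finite Ψ)
      (G : ConcurrentSafetyGame V X Y Φ Ψ), ∃ q ∈ G.positiveRegion,
      (∃ b : BehaviouralStrategy Φ X, G.IsPositive b.toMemoryStrategy q) ∧
      ∀ (M : Type) [Finite M] (σ : BehaviouralMemoryStrategy Φ X M),
        ¬ G.IsPositive σ.toMemoryStrategy q) := by
  refine ⟨?_, ?_⟩
  · intro V X Y Φ Ψ _ _ _ _ _ _ G
    obtain ⟨n, hn⟩ := G.exists_positiveRegion_eq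
    have hsafe : ∀ q ∈ G.positiveRegion, ∃ x : X, G.IsSafeAction q x := by
      intro q hq
      rw [hn] at hq
      exact G.exists_isSafeAction hq
    rw [hn] at hsafe ⊢
    refine ⟨?_, hsafe, fun act hact q hq => G.isPositive_soundChance hact hq⟩
    have : ∀ q, ∃ x : X, q ∈ (G.layer n)ᶜ → G.IsSafeAction q x := by
      intro q
      by_cases hq : q ∈ (G.layer n)ᶜ
      · exact (hsafe q hq).imp fun x hx _ => hx
      · exact ⟨Classical.arbitrary X, fun h => absurd h hq⟩
    choose act hact using this
    exact ⟨G.switchToSound act, fun q hq => G.isPositive_switchToSound hact hq⟩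
  · obtain ⟨b, hb⟩ := HideOrRun.exists_isPositive
    exact ⟨_, _, _, _, _, inferInstance, inferInstance, inferInstance, inferInstance,
      inferInstance, HideOrRun.game, none,
      HideOrRun.game.mem_positiveRegion_of_isPositive hb, ⟨b, hb⟩,
      fun M _ σ => HideOrRun.not_isPositive σ⟩
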